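/- **Setting.** Let $\mathrm{B}_n$ be the Artin braid group with its standard generators $\sigma_1,\dots,\sigma_{n-1}$, let $\mathrm{PB}_n=\ker(\rho:\mathrm{B}_n\to S_n)$ be the pure braid group, and let $x_{12}=\sigma_1^2\in\mathrm{PB}_2$. Let $\mathsf{N}\le \mathrm{PB}_4$ be a finite index normal subgroup of $\mathrm{B}_4$. For $n=2,3$ consider the $n+2$ homomorphisms $\mathrm{PB}_n\to\mathrm{PB}_{n+1}$ that add a straight strand on the left, add a straight strand on the right, or double the $i$-th strand ($1\le i\le n$). Let $\mathsf{N}_{\mathrm{PB}_3}\le\mathrm{PB}_3$ be the intersection of the preimages of $\mathsf{N}$ under the five homomorphisms with $n=3$, and let $\mathsf{N}_{\mathrm{PB}_2}\le\mathrm{PB}_2$ be the intersection of the preimages of $\mathsf{N}_{\mathrm{PB}_3}$ under the four homomorphisms with $n=2$. Put $\mathsf{N}_{\mathrm{PB}_4}=\mathsf{N}$, $\mathsf{N}_{\mathrm{PB}_1}=1$ and $N_{\mathrm{ord}}=[\mathrm{PB}_2:\mathsf{N}_{\mathrm{PB}_2}]$. Let $\mathsf{PaB}$ be the operad of parenthesized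 braids (an operad in groupoids). An object of $\mathsf{PaB}(n)$ is a parenthesized word in which each of the letters $1,\dots,n$ occurs exactly once. A morphism $\tau_1\to\tau_2$ is a braid $g\in \mathrm{B}_n$ whose underlying permutation carries $\tau_1$ to $\tau_2$. The group $S_n$ acts by relabelling, and $\circ_i$ replaces the letter $i$ by a word and the corresponding strand by a braid on parallel strands. Let $\beta:12\to 21$ be the morphism given by $\sigma_1$, and let $\alpha:(12)3\to 1(23)$ be the morphism given by $1\in\mathrm{B}_3$. For an object $\tau$ of $\mathsf{PaB}(n)$, an element $h\in \mathrm{PB}_n$ defines an automorphism of $\tau$. Write $\gamma\cdot h$ for the morphism obtained by first applying this automorphism of the source of $\gamma$ and then $\gamma$. For $n\le 4$ and morphisms $\gamma,\gamma':\tau_1\to\tau_2$ of $\mathsf{PaB}(n)$ given by braids $g,g'$, write $\gamma\sim_{\mathsf{N}}\gamma'$ if $g^{-1}g'\in\mathsf{N}_{\mathrm{PB}_n}$. The quotient $\mathsf{PaB}^{\le 4}/\!\sim_{\mathsf{N}}$ is a truncated operad in groupoids (arities $1$ to $4$) with the same objects as $\mathsf{PaB}^{\le4}$. Let $\mathsf{GTSh}$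 be the groupoid whose objects are the finite index normal subgroups $\mathsf{N}$ of $\mathrm{B}_4$ with $\mathsf{N}\le\mathrm{PB}_4$. A morphism $\mathsf{N}^{(1)}\to\mathsf{N}^{(2)}$ of $\mathsf{GTSh}$ is an isomorphism of truncated operads in groupoids $$T:\mathsf{PaB}^{\le4}/\!\sim_{\mathsf{N}^{(1)}}\ \to\ \mathsf{PaB}^{\le4}/\!\sim_{\mathsf{N}^{(2)}}$$ that is the identity on objects. Composition in $\mathsf{GTSh}$ is composition of isomorphisms. For $m\in\mathbb Z$ and $f\in\mathrm{PB}_3$ write $T=[(m,f)]$ if $$T([\beta])=[\beta\cdot x_{12}^{m}],\qquad T([\alpha])=[\alpha\cdot f].$$ **Statement.** 1. For every object $\mathsf{N}$ of $\mathsf{GTSh}$, the integer $N_{\mathrm{ord}}$ is positive, $\mathsf{N}_{\mathrm{PB}_2}=\langle x_{12}^{N_{\mathrm{ord}}}\rangle$, and there is an isomorphism $\mathrm{PB}_2/\mathsf{N}_{\mathrm{PB}_2}\cong\mathbb Z/N_{\mathrm{ord}}\mathbb Z$ sending the class of $x_{12}$ to $1$. 2. Every morphism $T:\mathsf{N}^{(1)}\to\mathsf{N}^{(2)}$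 of $\mathsf{GTSh}$ is of the form $[(m,f)]$ with $m\in\mathbb Z$ and $f\in\mathrm{PB}_3$. The pair is unique exactly up to changing $m$ modulo $N^{(2)}_{\mathrm{ord}}$ and $f$ modulo $\mathsf{N}^{(2)}_{\mathrm{PB}_3}$: if $T=[(m,f)]$, then $T=[(m',f')]$ if and only if $m\equiv m' \bmod N^{(2)}_{\mathrm{ord}}$ and $f^{-1}f'\in\mathsf{N}^{(2)}_{\mathrm{PB}_3}$. 3. There is a functor $Ch_{cyclot}$ (the *virtual cyclotomic character*) from $\mathsf{GTSh}$ to the category of finite cyclic groups such that * $Ch_{cyclot}(\mathsf{N})=\mathrm{PB}_2/\mathsf{N}_{\mathrm{PB}_2}$ for every object $\mathsf{N}$; * for every morphism $T=[(m,f)]:\mathsf{N}^{(1)}\to\mathsf{N}^{(2)}$ we have $\mathsf{N}^{(1)}_{\mathrm{PB}_2}=\mathsf{N}^{(2)}_{\mathrm{PB}_2}$, the rule $x_{12}\mapsto x_{12}^{2m+1}$ defines an automorphism of $\mathrm{PB}_2/\mathsf{N}^{(2)}_{\mathrm{PB}_2}$, and $Ch_{cyclot}(T)$ is this automorphism, viewed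 as a map $\mathrm{PB}_2/\mathsf{N}^{(1)}_{\mathrm{PB}_2}=\mathrm{PB}_2/\mathsf{N}^{(2)}_{\mathrm{PB}_2}\to\mathrm{PB}_2/\mathsf{N}^{(2)}_{\mathrm{PB}_2}$. -/

import Mathlib

namespace GTShadows

open CategoryTheory

/-- The Artin relations on the generators `σ_0, …, σ_{n-2}`. -/
def braidRels (n : ℕ) : Set (FreeGroup (Fin (n - 1))) :=
  {r | ∃ i j : Fin (n - 1), (i : ℕ) + 2 ≤ (j : ℕ) ∧
      r = FreeGroup.of i * FreeGroup.of j * (FreeGroup.of i)⁻¹ * (FreeGroup.of j)⁻¹} ∪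
  {r | ∃ i j : Fin (n - 1), (i : ℕ) + 1 = (j : ℕ) ∧
      r = FreeGroup.of i * FreeGroup.of j * FreeGroup.of i *
        (FreeGroup.of j)⁻¹ * (FreeGroup.of i)⁻¹ * (FreeGroup.of j)⁻¹}

/-- The Artin braid group on `n` strands. Positions are numbered `0, …, n - 1`. -/
abbrev B (n : ℕ) : Type := PresentedGroup (braidRels n)

/-- The generator `σ_j` exchanging the strands at positions `j` and `j + 1` (and `1` if there is no
such generator). -/
def sig (n j : ℕ) : B n := if h : j < n - 1 then PresentedGroup.of ⟨j, h⟩ else 1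

theorem of_eq_sig {n : ℕ} (j : Fin (n - 1)) :
    (PresentedGroup.of j : B n) = sig n j := by
  simp [sig]

theorem sig_comm (n : ℕ) {i j : ℕ} (h : i + 2 ≤ j) : sig n i * sig n j = sig n j * sig n i := by
  unfold sig
  split_ifs with hi hj
  · have := PresentedGroup.one_of_mem (rels := braidRels n)
      (x := FreeGroup.of ⟨i, hi⟩ * FreeGroup.of ⟨j, hj⟩ * (FreeGroup.of ⟨i, hi⟩)⁻¹ *
        (FreeGroup.of ⟨j, hj⟩)⁻¹) (Or.inl ⟨_, _, h, rfl⟩)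
    simp only [map_mul, map_inv] at this
    rw [mul_inv_eq_one, mul_inv_eq_iff_eq_mul] at this
    exact this
  all_goals simp

theorem sig_braid (n : ℕ) {i : ℕ} (h : i + 1 < n - 1) :
    sig n i * sig n (i + 1) * sig n i = sig n (i + 1) * sig n i * sig n (i + 1) := by
  have hi : i < n - 1 := by omega
  have := PresentedGroup.one_of_mem (rels := braidRels n)
      (x := FreeGroup.of ⟨i, hi⟩ * FreeGroup.of ⟨i + 1, h⟩ * FreeGroup.of ⟨i, hi⟩ *
        (FreeGroup.of ⟨i + 1, h⟩)⁻¹ * (FreeGroup.of ⟨i, hi⟩)⁻¹ * (FreeGroup.of ⟨i + 1, h⟩)⁻¹)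
      (Or.inr ⟨_, _, rfl, rfl⟩)
  simp only [map_mul, map_inv] at this
  rw [mul_inv_eq_one, mul_inv_eq_iff_eq_mul, mul_inv_eq_iff_eq_mul] at this
  unfold sig
  rw [dif_pos hi, dif_pos h]
  exact this

/-- A homomorphism out of the braid group from elements satisfying the Artin relations. -/
def braidLift {n : ℕ} {G : Type} [Group G] (s : ℕ → G)
    (hc : ∀ i j, i + 2 ≤ j → j < n - 1 → s i * s j = s j * s i)
    (hb : ∀ i, i + 1 < n - 1 → s i * s (i + 1) * s i = s (i + 1) * s i * s (i + 1)) :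
    B n →* G :=
  PresentedGroup.toGroup (f := fun j : Fin (n - 1) => s j) (by
    rintro r (⟨i, j, h, rfl⟩ | ⟨i, j, h, rfl⟩)
    · simp only [map_mul, map_inv, FreeGroup.lift_apply_of]
      rw [mul_inv_eq_one, mul_inv_eq_iff_eq_mul]
      exact hc i j h j.2
    · simp only [map_mul, map_inv, FreeGroup.lift_apply_of]
      rw [mul_inv_eq_one, mul_inv_eq_iff_eq_mul, mul_inv_eq_iff_eq_mul, ← h]
      exact hb i (by omega))

theorem braidLift_sig {n : ℕ} {G : Type} [Group G] (s : ℕ → G) (hc hb) {j : ℕ} (h : j < n - 1) :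
    braidLift (n := n) s hc hb (sig n j) = s j := by
  unfold sig braidLift
  rw [dif_pos h, PresentedGroup.toGroup.of]

theorem braid_induction {n : ℕ} {C : B n → Prop} (h1 : C 1) (hs : ∀ j, j < n - 1 → C (sig n j))
    (hm : ∀ a b, C a → C b → C (a * b)) (hi : ∀ a, C a → C a⁻¹) (g : B n) : C g := by
  have := PresentedGroup.generated_by (braidRels n)
    { carrier := {g | C g}, mul_mem' := fun {a b} => hm a b, one_mem' := h1,
      inv_mem' := fun {a} => hi a }
    (fun j => by
      have := hs j j.2
      rwa [← of_eq_sig] at this) g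
  exact this

/-- The transposition `(j, j + 1)` of positions (the identity if there is no position `j + 1`). -/
def transp (n j : ℕ) : Equiv.Perm (Fin n) :=
  if h : j + 1 < n then Equiv.swap ⟨j, by omega⟩ ⟨j + 1, h⟩ else 1

theorem transp_val {n j : ℕ} (h : j + 1 < n) (x : Fin n) : ((transp n j x : Fin n) : ℕ) =
    if (x : ℕ) = j then j + 1 else if (x : ℕ) = j + 1 then j else x := by
  unfold transp
  rw [dif_pos h, Equiv.swap_apply_def]
  simp only [Fin.ext_iff]
  split_ifs <;> rfl

theorem transp_inv (n j : ℕ) : (transp n j)⁻¹ = transp n j := by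
  unfold transp
  split_ifs
  · exact Equiv.swap_inv _ _
  · simp

theorem transp_comm (n : ℕ) {i j : ℕ} (h : i + 2 ≤ j) (hj : j < n - 1) :
    transp n i * transp n j = transp n j * transp n i := by
  ext x
  simp only [Equiv.Perm.mul_apply, transp_val (show i + 1 < n by omega),
    transp_val (show j + 1 < n by omega)]
  split_ifs <;> omega

theorem transp_braid (n : ℕ) {i : ℕ} (h : i + 1 < n - 1) :
    transp n i * transp n (i + 1) * transp n i =
      transp n (i + 1) * transp n i * transp n (i + 1) := by
  ext x
  simp only [Equiv.Perm.mul_apply, transp_val (show i + 1 < n by omega),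
    transp_val (show i + 1 + 1 < n by omega)]
  split_ifs <;> omega

/-- The standard homomorphism to the symmetric group: the strand of `g` that starts at position `k`
ends at position `ρ g k`. -/
def rho (n : ℕ) : B n →* Equiv.Perm (Fin n) :=
  braidLift (transp n) (fun _ _ h hj => transp_comm n h hj) (fun _ h => transp_braid n h)

theorem rho_sig {n j : ℕ} (h : j < n - 1) : rho n (sig n j) = transp n j :=
  braidLift_sig _ _ _ h

/-- The pure braid group. -/
abbrev PB (n : ℕ) : Subgroup (B n) := (rho n).ker

/-- The homomorphism `B_m → B_n` that places a braid on the positions `p, …, p + m - 1`, all other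
strands being straight: `σ_j ↦ σ_{p + j}`. -/
def shift {m n : ℕ} (p : ℕ) (h : p + m ≤ n) : B m →* B n :=
  braidLift (fun j => sig n (p + j)) (fun _ _ h _ => sig_comm n (by omega))
    (fun _ h => sig_braid n (by omega))

theorem shift_sig {m n p j : ℕ} (h : p + m ≤ n) (hj : j < m - 1) :
    shift p h (sig m j) = sig n (p + j) :=
  braidLift_sig _ _ _ hj

/-- The braid obtained from `σ_j ∈ B_n` by doubling the strand that starts at position `p`. -/
def dblGen (n j p : ℕ) : B (n + 1) :=
  if p < j then sig (n + 1) (j + 1)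
  else if p = j then sig (n + 1) j * sig (n + 1) (j + 1)
  else if p = j + 1 then sig (n + 1) (j + 1) * sig (n + 1) j
  else sig (n + 1) j

theorem dblGen_lt {n j p : ℕ} (h : p < j) : dblGen n j p = sig (n + 1) (j + 1) := by
  simp [dblGen, h]

theorem dblGen_self (n j : ℕ) : dblGen n j j = sig (n + 1) j * sig (n + 1) (j + 1) := by
  simp [dblGen]

theorem dblGen_succ (n j : ℕ) : dblGen n j (j + 1) = sig (n + 1) (j + 1) * sig (n + 1) j := by
  simp [dblGen]

theorem dblGen_gt {n j p : ℕ} (h : j + 1 < p) : dblGen n j p = sig (n + 1) j := by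
  simp [dblGen, show ¬ p < j by omega, show p ≠ j by omega, show p ≠ j + 1 by omega]

/-- The transposition `(j, j + 1)` of natural numbers. -/
def natTransp (j x : ℕ) : ℕ := if x = j then j + 1 else if x = j + 1 then j else x

theorem natTransp_self (j : ℕ) : natTransp j j = j + 1 := by simp [natTransp]

theorem natTransp_succ (j : ℕ) : natTransp j (j + 1) = j := by simp [natTransp]

theorem natTransp_ne {j x : ℕ} (h : x ≠ j) (h' : x ≠ j + 1) : natTransp j x = x := by
  simp [natTransp, h, h']

theorem dblGen_comm (n : ℕ) {i j : ℕ} (h : i + 2 ≤ j) (x : ℕ) :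
    dblGen n i (natTransp i x) * dblGen n j (natTransp j (natTransp i x)) =
      dblGen n j (natTransp j x) * dblGen n i (natTransp i (natTransp j x)) := by
  have e1 := sig_comm (n + 1) h
  have e2 := sig_comm (n + 1) (show i + 2 ≤ j + 1 by omega)
  have e3 := sig_comm (n + 1) (show i + 1 + 2 ≤ j + 1 by omega)
  rcases lt_trichotomy x i with h1 | rfl | h1
  · simp (disch := omega) only [natTransp_ne, dblGen_lt, e3]
  · simp (disch := omega) only [natTransp_ne, natTransp_self, dblGen_lt, dblGen_succ]
    rw [mul_assoc, e2, ← mul_assoc, e3, mul_assoc]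
  rcases Nat.lt_trichotomy x (i + 1) with h2 | rfl | h2
  · omega
  · simp (disch := omega) only [natTransp_ne, natTransp_succ, dblGen_lt, dblGen_self]
    rw [mul_assoc, e3, ← mul_assoc, e2, mul_assoc]
  rcases lt_trichotomy x j with h3 | rfl | h3
  · simp (disch := omega) only [natTransp_ne, dblGen_lt, dblGen_gt, e2]
  · simp (disch := omega) only [natTransp_ne, natTransp_self, dblGen_gt, dblGen_succ]
    rw [mul_assoc, ← e1, ← mul_assoc, e2, mul_assoc]
  rcases Nat.lt_trichotomy x (j + 1) with h4 | rfl | h4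
  · omega
  · simp (disch := omega) only [natTransp_ne, natTransp_succ, dblGen_gt, dblGen_self]
    rw [mul_assoc, ← e2, ← mul_assoc, e1, mul_assoc]
  · simp (disch := omega) only [natTransp_ne, dblGen_gt, e1]

theorem word_one {G : Type} [Group G] {a b c : G} (h1 : a * b * a = b * a * b)
    (h2 : b * c * b = c * b * c) (h3 : a * c = c * a) :
    b * a * (c * b) * a = c * (b * a) * (c * b) := by
  calc b * a * (c * b) * a = b * (a * c) * (b * a) := by group
    _ = b * c * (a * b * a) := by rw [h3]; group
    _ = (b * c * b) * a * b := by rw [h1]; group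
    _ = c * b * (c * a) * b := by rw [h2]; group
    _ = c * (b * a) * (c * b) := by rw [← h3]; group

theorem word_two {G : Type} [Group G] {a b c : G} (h1 : a * b * a = b * a * b)
    (h2 : b * c * b = c * b * c) (h3 : a * c = c * a) :
    a * b * c * (b * a) = c * b * a * (b * c) := by
  calc a * b * c * (b * a) = a * (b * c * b) * a := by group
    _ = (a * c) * b * (c * a) := by rw [h2]; group
    _ = c * (a * b * a) * c := by rw [← h3, h3]; simp only [mul_assoc]; rw [h3]
    _ = c * b * a * (b * c) := by rw [h1]; group

theorem word_three {G : Type} [Group G] {a b c : G} (h1 : a * b * a = b * a * b)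
    (h2 : b * c * b = c * b * c) (h3 : a * c = c * a) :
    a * (b * c) * (a * b) = b * c * (a * b) * c := by
  calc a * (b * c) * (a * b) = a * b * (c * a) * b := by group
    _ = (a * b * a) * c * b := by rw [← h3]; group
    _ = b * a * (b * c * b) := by rw [h1]; group
    _ = b * (a * c) * b * c := by rw [h2]; group
    _ = b * c * (a * b) * c := by rw [h3]; group

theorem dblGen_braid (n : ℕ) {i : ℕ} (h : i + 1 < n - 1) (x : ℕ) :
    dblGen n i (natTransp i x) * dblGen n (i + 1) (natTransp (i + 1) (natTransp i x)) *
      dblGen n i (natTransp i (natTransp (i + 1) (natTransp i x))) =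
    dblGen n (i + 1) (natTransp (i + 1) x) * dblGen n i (natTransp i (natTransp (i + 1) x)) *
      dblGen n (i + 1) (natTransp (i + 1) (natTransp i (natTransp (i + 1) x))) := by
  have e1 := sig_braid (n + 1) (show i + 1 < n + 1 - 1 by omega)
  have e2 := sig_braid (n + 1) (show i + 1 + 1 < n + 1 - 1 by omega)
  have e3 := sig_comm (n + 1) (show i + 2 ≤ i + 1 + 1 by omega)
  rcases lt_trichotomy x i with h1 | rfl | h1
  · simp (disch := omega) only [natTransp_ne, dblGen_lt, e2]
  · simp (disch := omega) only [natTransp_ne, natTransp_self, dblGen_lt, dblGen_gt, dblGen_succ]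
    exact word_one e1 e2 e3
  rcases Nat.lt_trichotomy x (i + 1) with h2 | rfl | h2
  · omega
  · simp (disch := omega) only [natTransp_ne, natTransp_succ, natTransp_self, dblGen_lt, dblGen_gt,
      dblGen_self, dblGen_succ]
    exact word_two e1 e2 e3
  rcases Nat.lt_trichotomy x (i + 1 + 1) with h3 | rfl | h3
  · omega
  · simp (disch := omega) only [natTransp_ne, natTransp_succ, dblGen_lt, dblGen_gt, dblGen_self]
    exact word_three e1 e2 e3
  · simp (disch := omega) only [natTransp_ne, dblGen_gt, e1]

theorem transp_eq_natTransp {n j : ℕ} (h : j < n - 1) (x : Fin n) :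
    ((transp n j x : Fin n) : ℕ) = natTransp j x :=
  transp_val (by omega) x

theorem arrow_apply {n : ℕ} {G : Type} [Group G] (s : Equiv.Perm (Fin n)) (F : Fin n → G)
    (q : Fin n) : (mulAutArrow s : MulAut (Fin n → G)) F q = F (s⁻¹ q) := rfl

/-- The homomorphism `B_n → B_{n+1}^n ⋊ S_n` whose second component is `ρ`, and whose first
component records, for every position `q`, the braid obtained by doubling the strand that ends at
`q`. -/
def dblHom (n : ℕ) : B n →* (Fin n → B (n + 1)) ⋊[mulAutArrow] Equiv.Perm (Fin n) :=
  braidLift (fun j => ⟨fun q => dblGen n j (natTransp j q), transp n j⟩)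
    (by
      intro i j h hj
      refine SemidirectProduct.ext (funext fun q => ?_) (transp_comm n h hj)
      simp only [SemidirectProduct.mul_left, Pi.mul_apply, arrow_apply,
        transp_inv, transp_eq_natTransp hj, transp_eq_natTransp (show i < n - 1 by omega)]
      exact dblGen_comm n h q)
    (by
      intro i h
      refine SemidirectProduct.ext (funext fun q => ?_) (transp_braid n h)
      simp only [SemidirectProduct.mul_left, SemidirectProduct.mul_right, Pi.mul_apply,
        arrow_apply, mul_inv_rev, transp_inv,
        Equiv.Perm.mul_apply,
        transp_eq_natTransp h, transp_eq_natTransp (show i < n - 1 by omega)]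
      exact dblGen_braid n h q)

theorem dblHom_right (n : ℕ) (g : B n) : (dblHom n g).right = rho n g := by
  induction g using braid_induction with
  | h1 => simp
  | hs j h => rw [dblHom, braidLift_sig _ _ _ h, rho_sig h]
  | hm a b ha hb => simp [ha, hb]
  | hi a ha => simp [ha]

/-- The braid obtained from `g` by replacing the strand that starts at position `p` by two parallel
strands. -/
def dbl {n : ℕ} (g : B n) (p : Fin n) : B (n + 1) := (dblHom n g).left (rho n g p)

theorem dbl_one {n : ℕ} (p : Fin n) : dbl 1 p = 1 := by simp [dbl]

theorem dbl_mul {n : ℕ} (g h : B n) (p : Fin n) :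
    dbl (g * h) p = dbl g (rho n h p) * dbl h p := by
  simp [dbl, dblHom_right, SemidirectProduct.mul_left, arrow_apply, -mulAutArrow_apply_apply]

theorem dbl_inv {n : ℕ} (g : B n) (p : Fin n) : dbl g⁻¹ p = (dbl g ((rho n g)⁻¹ p))⁻¹ := by
  rw [eq_inv_iff_mul_eq_one, ← dbl_one ((rho n g)⁻¹ p), ← inv_mul_cancel g, dbl_mul]
  simp

theorem dbl_sig {n j : ℕ} (h : j < n - 1) (p : Fin n) : dbl (sig n j) p = dblGen n j p := by
  rw [dbl, dblHom, braidLift_sig _ _ _ h, rho_sig h]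
  simp only [transp_eq_natTransp h]
  congr 1
  unfold natTransp
  split_ifs <;> omega

/-- The position (or label) of an old strand `x` after the strand `c` has been replaced by `m + 1`
strands. -/
def bump (m c x : ℕ) : ℕ := if x < c then x else x + m

/-- `g'` moves strands as the braid obtained from `g` by replacing the strand starting at `p` by
`m + 1` parallel strands. -/
def IsCable {n k : ℕ} (m : ℕ) (g : Equiv.Perm (Fin n)) (p : Fin n) (g' : Equiv.Perm (Fin k)) :
    Prop :=
  (∀ (q : Fin k) (t : ℕ), t ≤ m → (q : ℕ) = p + t → ((g' q : Fin k) : ℕ) = (g p : Fin n) + t) ∧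
  ∀ (q : Fin k) (x : Fin n), x ≠ p → (q : ℕ) = bump m p x →
    ((g' q : Fin k) : ℕ) = bump m (g p : Fin n) (g x : Fin n)

theorem isCable_one {n k m : ℕ} (p : Fin n) : IsCable (k := k) m 1 p 1 := by
  constructor
  · intro q t _ h; simpa using h
  · intro q x _ h; simpa using h

theorem IsCable.mul {n k m : ℕ} {g h : Equiv.Perm (Fin n)} {p : Fin n} {g' h' : Equiv.Perm (Fin k)}
    (hg : IsCable m g (h p) g') (hh : IsCable m h p h') : IsCable m (g * h) p (g' * h') := by
  constructor
  · intro q t ht hq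
    exact hg.1 _ t ht (hh.1 q t ht hq)
  · intro q x hx hq
    exact hg.2 _ (h x) (fun e => hx (h.injective e)) (hh.2 q x hx hq)

theorem IsCable.inv {n k m : ℕ} (hk : k = n + m) {g : Equiv.Perm (Fin n)} {p : Fin n}
    {g' : Equiv.Perm (Fin k)} (hg : IsCable m g (g⁻¹ p) g') : IsCable m g⁻¹ p g'⁻¹ := by
  constructor
  · intro q t ht hq
    have hlt : ((g⁻¹ p : Fin n) : ℕ) + t < k := by
      have := (g⁻¹ p : Fin n).2
      omega
    have := hg.1 ⟨_, hlt⟩ t ht rfl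
    have e : g' ⟨_, hlt⟩ = q := by
      apply Fin.ext
      rw [this, hq]
      simp
    rw [← e]
    simp
  · intro q x hx hq
    have hlt : bump m (g⁻¹ p : Fin n) (g⁻¹ x : Fin n) < k := by
      have := (g⁻¹ x : Fin n).2
      unfold bump
      split_ifs <;> omega
    have := hg.2 ⟨_, hlt⟩ (g⁻¹ x) (fun e => hx (g⁻¹.injective e)) rfl
    have e : g' ⟨_, hlt⟩ = q := by
      apply Fin.ext
      rw [this, hq]
      simp
    rw [← e]
    simp

theorem natTransp_bump_lt {j p x : ℕ} (h : p < j) (_ : x ≠ p) :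
    natTransp (j + 1) (bump 1 p x) = bump 1 (natTransp j p) (natTransp j x) := by
  rw [natTransp_ne (x := p) (by omega) (by omega)]
  unfold natTransp bump; split_ifs <;> omega

theorem natTransp_bump_gt {j p x : ℕ} (h : j + 1 < p) (_ : x ≠ p) :
    natTransp j (bump 1 p x) = bump 1 (natTransp j p) (natTransp j x) := by
  rw [natTransp_ne (x := p) (by omega) (by omega)]
  unfold natTransp bump; split_ifs <;> omega

theorem natTransp_bump_self {j x : ℕ} (hx : x ≠ j) :
    natTransp j (natTransp (j + 1) (bump 1 j x)) = bump 1 (natTransp j j) (natTransp j x) := by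
  rw [natTransp_self]
  unfold bump
  rcases lt_trichotomy x j with h | h | h
  · simp (disch := omega) only [natTransp_ne, if_pos]
  · omega
  · by_cases h' : x = j + 1
    · subst h'
      simp (disch := omega) only [natTransp_succ, if_pos, if_neg]
    · simp (disch := omega) only [natTransp_ne, if_neg]

theorem natTransp_bump_succ {j x : ℕ} (hx : x ≠ j + 1) :
    natTransp (j + 1) (natTransp j (bump 1 (j + 1) x)) =
      bump 1 (natTransp j (j + 1)) (natTransp j x) := by
  rw [natTransp_succ]
  unfold bump
  rcases lt_trichotomy x j with h | h | h
  · simp (disch := omega) only [natTransp_ne, if_pos]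
  · subst h
    simp (disch := omega) only [natTransp_self, if_pos, if_neg]
  · simp (disch := omega) only [natTransp_ne, if_neg]

theorem isCable_transp {n j : ℕ} (h : j < n - 1) (p : Fin n) :
    IsCable 1 (transp n j) p (rho (n + 1) (dblGen n j p)) := by
  have hs : ∀ i, i < n → ∀ q : Fin (n + 1),
      ((rho (n + 1) (sig (n + 1) i) q : Fin (n + 1)) : ℕ) = natTransp i q := by
    intro i hi q
    rw [rho_sig (by omega), transp_eq_natTransp (by omega)]
  have h0 := hs j (by omega)
  have h1 := hs (j + 1) (by omega)
  have hT := transp_eq_natTransp h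
  have hne : ∀ x : Fin n, x ≠ p → (x : ℕ) ≠ p := fun x hx e => hx (Fin.ext e)
  clear hs
  rcases lt_trichotomy (p : ℕ) j with hp | hp | hp
  · rw [dblGen_lt hp]
    constructor
    · intro q t _ _
      rw [h1, hT]; unfold natTransp; split_ifs <;> omega
    · intro q x hx hq
      rw [h1, hT, hT, hq, natTransp_bump_lt hp (hne x hx)]
  · rw [hp, dblGen_self]
    constructor
    · intro q t _ _
      rw [map_mul, Equiv.Perm.mul_apply, h0, h1, hT]; unfold natTransp; split_ifs <;> omega
    · intro q x hx hq
      rw [map_mul, Equiv.Perm.mul_apply, h0, h1, hT, hT, hq, hp,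
        natTransp_bump_self (hp ▸ hne x hx)]
  rcases Nat.lt_trichotomy (p : ℕ) (j + 1) with hp' | hp' | hp'
  · omega
  · rw [hp', dblGen_succ]
    constructor
    · intro q t _ _
      rw [map_mul, Equiv.Perm.mul_apply, h1, h0, hT]; unfold natTransp; split_ifs <;> omega
    · intro q x hx hq
      rw [map_mul, Equiv.Perm.mul_apply, h1, h0, hT, hT, hq, hp',
        natTransp_bump_succ (hp' ▸ hne x hx)]
  · rw [dblGen_gt hp']
    constructor
    · intro q t _ _
      rw [h0, hT]; unfold natTransp; split_ifs <;> omega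
    · intro q x hx hq
      rw [h0, hT, hT, hq, natTransp_bump_gt hp' (hne x hx)]

theorem isCable_dbl {n : ℕ} (g : B n) : ∀ p, IsCable 1 (rho n g) p (rho (n + 1) (dbl g p)) := by
  induction g using braid_induction with
  | h1 => intro p; rw [dbl_one, map_one, map_one]; exact isCable_one p
  | hs j h => intro p; rw [dbl_sig h, rho_sig h]; exact isCable_transp h p
  | hm a b ha hb => intro p; rw [dbl_mul, map_mul, map_mul]; exact (ha _).mul (hb p)
  | hi a ha => intro p; rw [dbl_inv, map_inv, map_inv]; exact (ha _).inv rfl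

/-- The braid obtained from `g` by replacing the strand that starts at position `p` by `m + 1`
parallel strands. -/
def cable {n : ℕ} (g : B (n + 1)) (p : Fin (n + 1)) : (m : ℕ) → B (n + m + 1)
  | 0 => g
  | m + 1 => dbl (cable g p m) ⟨p, by omega⟩

theorem isCable_cable {n : ℕ} (g : B (n + 1)) (p : Fin (n + 1)) (m : ℕ) :
    IsCable m (rho (n + 1) g) p (rho (n + m + 1) (cable g p m)) := by
  induction m with
  | zero =>
    constructor
    · intro q t ht hq
      have : q = p := Fin.ext (by omega)
      rw [this, show t = 0 by omega]; rfl
    · intro q x hx hq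
      have : q = x := Fin.ext (by unfold bump at hq; split_ifs at hq <;> omega)
      rw [this]; unfold bump; split_ifs <;> rfl
  | succ m ih =>
    have hd : IsCable 1 (rho (n + m + 1) (cable g p m)) ⟨p, by omega⟩
        (rho (n + (m + 1) + 1) (cable g p (m + 1))) := isCable_dbl (cable g p m) ⟨p, by omega⟩
    have h0 := ih.1 ⟨p, by omega⟩ 0 (by omega) rfl
    constructor
    · intro q t ht hq
      by_cases h : t ≤ 1
      · rw [hd.1 q t h hq, h0]; rfl
      · have h1 := ih.1 ⟨p + (t - 1), by omega⟩ (t - 1) (by omega) rfl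
        rw [hd.2 q ⟨p + (t - 1), by omega⟩ (by simp [Fin.ext_iff]; omega)
          (by simp only [bump]; split_ifs <;> omega), h0, h1]
        unfold bump; split_ifs <;> omega
    · intro q x hx hq
      have hxp : (x : ℕ) ≠ p := fun e => hx (Fin.ext e)
      have hne : ((rho (n + 1) g x : Fin (n + 1)) : ℕ) ≠ (rho (n + 1) g p : Fin (n + 1)) :=
        fun e => hx ((rho (n + 1) g).injective (Fin.ext e))
      have hlt : bump m p x < n + m + 1 := by unfold bump; split_ifs <;> omega
      have h1 := ih.2 ⟨bump m p x, hlt⟩ x hx rfl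
      rw [hd.2 q ⟨bump m p x, hlt⟩
        (by simp only [bump, Ne, Fin.ext_iff]; split_ifs <;> omega)
        (by rw [hq]; simp only [bump]; split_ifs <;> omega), h0, h1]
      unfold bump; split_ifs <;> omega

theorem cable_mul {n : ℕ} (g h : B (n + 1)) (p : Fin (n + 1)) (m : ℕ) :
    cable (g * h) p m = cable g (rho (n + 1) h p) m * cable h p m := by
  induction m with
  | zero => rfl
  | succ m ih =>
    have e : rho (n + m + 1) (cable h p m) ⟨p, by omega⟩ =
        ⟨(rho (n + 1) h p : Fin (n + 1)), by omega⟩ :=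
      Fin.ext ((isCable_cable h p m).1 ⟨p, by omega⟩ 0 (by omega) rfl)
    have h1 : dbl (cable g (rho (n + 1) h p) m * cable h p m) ⟨p, by omega⟩ =
        dbl (cable g (rho (n + 1) h p) m) (rho (n + m + 1) (cable h p m) ⟨p, by omega⟩) *
          dbl (cable h p m) ⟨p, by omega⟩ := dbl_mul _ _ _
    rw [cable, ih, h1, e]
    rfl

theorem rho_shift_mid {m n p : ℕ} (h : p + m ≤ n) (g : B m) : ∀ (t : Fin m) (q : Fin n),
    (q : ℕ) = p + t →
    ((rho n (shift p h g) q : Fin n) : ℕ) = p + (rho m g t : Fin m) := by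
  induction g using braid_induction with
  | h1 => intro t q hq; simpa using hq
  | hs j hj =>
    intro t q hq
    rw [shift_sig h hj, rho_sig (by omega), rho_sig hj, transp_eq_natTransp (by omega),
      transp_eq_natTransp hj]
    unfold natTransp; split_ifs <;> omega
  | hm a b ha hb =>
    intro t q hq
    rw [map_mul, map_mul, map_mul]
    exact ha _ _ (hb t q hq)
  | hi a ha =>
    intro t q hq
    have hlt : p + ((rho m a)⁻¹ t : Fin m) < n := by omega
    have := ha ((rho m a)⁻¹ t) ⟨_, hlt⟩ rfl
    have e : rho n (shift p h a) ⟨_, hlt⟩ = q := by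
      apply Fin.ext
      rw [this, hq]
      simp
    rw [← e]
    simp

theorem rho_shift_out {m n p : ℕ} (h : p + m ≤ n) (g : B m) : ∀ (q : Fin n),
    ((q : ℕ) < p ∨ p + m ≤ q) → rho n (shift p h g) q = q := by
  induction g using braid_induction with
  | h1 => intro q _; simp
  | hs j hj =>
    intro q hq
    apply Fin.ext
    rw [shift_sig h hj, rho_sig (by omega), transp_eq_natTransp (by omega)]
    unfold natTransp; split_ifs <;> omega
  | hm a b ha hb =>
    intro q hq
    rw [map_mul, map_mul, Equiv.Perm.mul_apply, hb q hq, ha q hq]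
  | hi a ha =>
    intro q hq
    rw [map_inv, map_inv, Equiv.Perm.inv_eq_iff_eq, ha q hq]

/-- Doubling the strand of a pure braid that starts (and ends) at position `p`. For `n = 3` these
are the coface maps `φ_{12,3,4}`, `φ_{1,23,4}`, `φ_{1,2,34}`, and for `n = 2` they are `φ_{12,3}`,
`φ_{1,23}`. -/
def cofaceDbl {n : ℕ} (p : Fin n) : PB n →* B (n + 1) where
  toFun h := dbl (h : B n) p
  map_one' := dbl_one p
  map_mul' a b := by
    have : rho n (b : B n) = 1 := b.2
    rw [Subgroup.coe_mul, dbl_mul, this]; rfl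

/-- Adding a straight strand on the right: `φ_{123}` for `n = 3` and `φ_{12}` for `n = 2`. -/
def cofaceRight (n : ℕ) : PB n →* B (n + 1) :=
  (shift 0 (by omega)).comp (PB n).subtype

/-- Adding a straight strand on the left: `φ_{234}` for `n = 3` and `φ_{23}` for `n = 2`. -/
def cofaceLeft (n : ℕ) : PB n →* B (n + 1) :=
  (shift 1 (by omega)).comp (PB n).subtype

/-- The intersection, in `PB_n`, of the preimages of `M` under all the coface maps. -/
def pull {n : ℕ} (M : Subgroup (B (n + 1))) : Subgroup (B n) :=
  (M.comap (cofaceRight n) ⊓ M.comap (cofaceLeft n) ⊓ ⨅ p, M.comap (cofaceDbl p)).map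
    (PB n).subtype

theorem mem_pull {n : ℕ} {M : Subgroup (B (n + 1))} {g : B n} :
    g ∈ pull M ↔ g ∈ PB n ∧ shift 0 (by omega) g ∈ M ∧ shift 1 (by omega) g ∈ M ∧
      ∀ p, dbl g p ∈ M := by
  simp only [pull, Subgroup.mem_map, Subgroup.mem_inf, Subgroup.mem_comap, Subgroup.mem_iInf]
  constructor
  · rintro ⟨h, ⟨⟨h1, h2⟩, h3⟩, rfl⟩
    exact ⟨h.2, h1, h2, h3⟩
  · rintro ⟨h, h1, h2, h3⟩
    exact ⟨⟨g, h⟩, ⟨⟨h1, h2⟩, h3⟩, rfl⟩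

theorem pull_normal {n : ℕ} {M : Subgroup (B (n + 1))} (hM : M.Normal) : (pull M).Normal := by
  refine ⟨fun h hh g => ?_⟩
  rw [mem_pull] at hh ⊢
  obtain ⟨h0, h1, h2, h3⟩ := hh
  refine ⟨(inferInstance : (PB n).Normal).conj_mem h h0 g, ?_, ?_, fun p => ?_⟩
  · rw [map_mul, map_mul, map_inv]; exact hM.conj_mem _ h1 _
  · rw [map_mul, map_mul, map_inv]; exact hM.conj_mem _ h2 _
  · have e : rho n h = 1 := h0
    rw [dbl_mul, dbl_mul, dbl_inv, map_inv, e]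
    exact hM.conj_mem _ (h3 _) _

theorem pull_finiteIndex {n : ℕ} {M : Subgroup (B (n + 1))} (hM : M.FiniteIndex) :
    (pull M).FiniteIndex := by
  have hc : ∀ f : PB n →* B (n + 1), (M.comap f).FiniteIndex := by
    intro f
    refine ⟨?_⟩
    rw [Subgroup.index_comap]
    exact (inferInstance : (M.subgroupOf f.range).FiniteIndex).index_ne_zero
  have := Subgroup.finiteIndex_iInf fun p => hc (cofaceDbl p)
  have := hc (cofaceRight n)
  have := hc (cofaceLeft n)
  refine ⟨?_⟩
  rw [pull, Subgroup.index_map_subtype]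
  exact mul_ne_zero Subgroup.FiniteIndex.index_ne_zero Subgroup.FiniteIndex.index_ne_zero

/-- The objects of the groupoid of `GT`-shadows: finite index normal subgroups of `B_4` that are
contained in `PB_4`. -/
structure GTSh where
  N : Subgroup (B 4)
  normal : N.Normal
  finiteIndex : N.FiniteIndex
  le_PB : N ≤ PB 4

namespace GTSh

/-- The subgroups `N_{PB_n}` of `B_n` attached to `N`, for `n ≤ 4`. -/
def sub (N : GTSh) : (n : ℕ) → Subgroup (B n)
  | 4 => N.N
  | 3 => pull N.N
  | 2 => pull (pull N.N)
  | _ => ⊥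

theorem sub_normal (N : GTSh) (n : ℕ) : (N.sub n).Normal := by
  unfold sub
  split
  · exact N.normal
  · exact pull_normal N.normal
  · exact pull_normal (pull_normal N.normal)
  · infer_instance

theorem sub_le_PB (N : GTSh) (n : ℕ) : N.sub n ≤ PB n := by
  unfold sub
  split
  · exact N.le_PB
  · exact fun g hg => (mem_pull.1 hg).1
  · exact fun g hg => (mem_pull.1 hg).1
  · exact bot_le

theorem sub_one (N : GTSh) : N.sub 1 = ⊥ := rfl

theorem sub_step (N : GTSh) {k : ℕ} (hk : 1 ≤ k) (hk' : k + 1 ≤ 4) {g : B k} (hg : g ∈ N.sub k) :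
    shift 0 (by omega) g ∈ N.sub (k + 1) ∧ shift 1 (by omega) g ∈ N.sub (k + 1) ∧
      ∀ p, dbl g p ∈ N.sub (k + 1) := by
  obtain rfl | rfl | rfl : k = 1 ∨ k = 2 ∨ k = 3 := by omega
  · rw [sub_one, Subgroup.mem_bot] at hg
    subst hg
    refine ⟨?_, ?_, fun p => ?_⟩
    · rw [map_one]; exact one_mem _
    · rw [map_one]; exact one_mem _
    · rw [dbl_one]; exact one_mem _
  · exact (mem_pull.1 hg).2
  · exact (mem_pull.1 hg).2

theorem cable_mem_sub (N : GTSh) {n : ℕ} {g : B (n + 1)} (hg : g ∈ N.sub (n + 1))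
    (p : Fin (n + 1)) : ∀ m, n + m + 1 ≤ 4 → cable g p m ∈ N.sub (n + m + 1)
  | 0, _ => hg
  | m + 1, h => (N.sub_step (by omega) h (cable_mem_sub N hg p m (by omega))).2.2 _

theorem shift_shift {a b c p q : ℕ} (h : p + a ≤ b) (h' : q + b ≤ c) (g : B a) :
    shift q h' (shift p h g) = shift (q + p) (by omega) g := by
  induction g using braid_induction with
  | h1 => simp
  | hs j hj => rw [shift_sig _ hj, shift_sig _ (by omega), shift_sig _ hj, add_assoc]
  | hm a b ha hb => simp only [map_mul, ha, hb]
  | hi a ha => simp only [map_inv, ha]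

theorem shift_zero_self {a : ℕ} (g : B a) : shift 0 (by omega) g = g := by
  induction g using braid_induction with
  | h1 => simp
  | hs j hj => rw [shift_sig _ hj, zero_add]
  | hm a b ha hb => simp only [map_mul, ha, hb]
  | hi a ha => simp only [map_inv, ha]

theorem shift_mem_sub (N : GTSh) {m : ℕ} (hm : 1 ≤ m) {g : B m} (hg : g ∈ N.sub m) :
    ∀ (d p : ℕ) (hp : p ≤ d), m + d ≤ 4 → shift p (by omega) g ∈ N.sub (m + d)
  | 0, p, hp, _ => by
    obtain rfl : p = 0 := by omega
    rw [show shift 0 (by omega) g = g from shift_zero_self g]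
    exact hg
  | d + 1, 0, _, h => by
    have := (N.sub_step (k := m + d) (by omega) h (shift_mem_sub N hm hg d 0 (by omega) (by omega))).1
    rwa [shift_shift] at this
  | d + 1, p + 1, _, h => by
    have := (N.sub_step (k := m + d) (by omega) h (shift_mem_sub N hm hg d p (by omega) (by omega))).2.1
    rw [shift_shift] at this
    simp only [add_comm 1 p] at this
    exact this

theorem insert_mem_sub (N : GTSh) {n m : ℕ} (h : n + m + 1 ≤ 4) (p : Fin (n + 1))
    {g g' : B (n + 1)} {k k' : B (m + 1)} (hr : rho (n + 1) g = rho (n + 1) g')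
    (hg : g⁻¹ * g' ∈ N.sub (n + 1)) (hk : k⁻¹ * k' ∈ N.sub (m + 1)) :
    (cable g p m * shift (p : ℕ) (by omega) k)⁻¹ * (cable g' p m * shift (p : ℕ) (by omega) k') ∈
      N.sub (n + m + 1) := by
  have h1 : (cable g p m)⁻¹ * cable g' p m ∈ N.sub (n + m + 1) := by
    have hm := N.cable_mem_sub hg p m h
    have e : cable (g * (g⁻¹ * g')) p m = cable g p m * cable (g⁻¹ * g') p m := by
      rw [cable_mul, map_mul, map_inv, hr, inv_mul_cancel]; rfl
    rw [mul_inv_cancel_left] at e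
    rw [e, inv_mul_cancel_left]
    exact hm
  have h2 : ∀ (l : ℕ) (_ : m + 1 + n = l) (hl : (p : ℕ) + (m + 1) ≤ l),
      shift (p : ℕ) hl (k⁻¹ * k') ∈ N.sub l := by
    rintro l rfl hl
    exact N.shift_mem_sub (by omega) hk n p (by omega) (by omega)
  have h3 := h2 (n + m + 1) (by omega) (by omega)
  rw [map_mul, map_inv] at h3
  have h4 := mul_mem ((N.sub_normal _).conj_mem _ h1 (shift (p : ℕ) (by omega) k)⁻¹) h3
  convert h4 using 1
  group

end GTSh

/-- The sequence of letters of a parenthesized word. -/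
def leaves {α : Type} : FreeMagma α → List α
  | .of x => [x]
  | .mul x y => leaves x ++ leaves y

theorem leaves_of {α : Type} (x : α) : leaves (FreeMagma.of x) = [x] := rfl

theorem leaves_mul {α : Type} (x y : FreeMagma α) : leaves (x * y) = leaves x ++ leaves y := rfl

theorem leaves_lift {α β : Type} (f : α → FreeMagma β) (x : FreeMagma α) :
    leaves (FreeMagma.lift f x) = (leaves x).flatMap fun a => leaves (f a) := by
  induction x using FreeMagma.recOnMul with
  | ih1 x => simp [leaves_of]
  | ih2 x y hx hy => rw [map_mul, leaves_mul, leaves_mul, hx, hy, List.flatMap_append]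

theorem leaves_map {α β : Type} (f : α → β) (x : FreeMagma α) :
    leaves (FreeMagma.map f x) = (leaves x).map f := by
  induction x using FreeMagma.recOnMul with
  | ih1 x => simp [leaves_of]
  | ih2 x y hx hy => rw [map_mul, leaves_mul, leaves_mul, hx, hy, List.map_append]

/-- The objects of `PaB(n)`: parenthesized words in the letters `0, …, n - 1` in which each letter
appears exactly once. -/
@[ext]
structure PaB (n : ℕ) where
  word : FreeMagma (Fin n)
  nodup : (leaves word).Nodup
  mem : ∀ i, i ∈ leaves word

namespace PaB

theorem length_leaves {n : ℕ} (τ : PaB n) : (leaves τ.word).length = n :=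
  Fin.equiv_iff_eq.1 ⟨τ.nodup.getEquivOfForallMemList _ τ.mem⟩

/-- The permutation underlying an object: `perm τ k` is the letter at position `k`. -/
def perm {n : ℕ} (τ : PaB n) : Equiv.Perm (Fin n) :=
  (finCongr τ.length_leaves.symm).trans (τ.nodup.getEquivOfForallMemList _ τ.mem)

theorem getElem?_leaves {n : ℕ} (τ : PaB n) (k : Fin n) :
    (leaves τ.word)[(k : ℕ)]? = some (perm τ k) := by
  have hk : (k : ℕ) < (leaves τ.word).length := by rw [τ.length_leaves]; exact k.2
  rw [List.getElem?_eq_getElem hk]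
  rfl

theorem perm_eq_of_getElem? {n : ℕ} {τ : PaB n} {k i : Fin n}
    (h : (leaves τ.word)[(k : ℕ)]? = some i) : perm τ k = i := by
  rw [getElem?_leaves] at h
  exact Option.some.inj h

/-- The action of `S_n` on objects: relabelling of the letters. -/
instance (n : ℕ) : SMul (Equiv.Perm (Fin n)) (PaB n) where
  smul θ τ :=
    { word := FreeMagma.map θ τ.word
      nodup := by rw [leaves_map]; exact τ.nodup.map θ.injective
      mem := fun i => by
        rw [leaves_map, List.mem_map]
        exact ⟨θ⁻¹ i, τ.mem _, by simp⟩ }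

theorem smul_word {n : ℕ} (θ : Equiv.Perm (Fin n)) (τ : PaB n) :
    (θ • τ).word = FreeMagma.map θ τ.word := rfl

theorem perm_smul {n : ℕ} (θ : Equiv.Perm (Fin n)) (τ : PaB n) : perm (θ • τ) = θ * perm τ := by
  ext1 k
  apply perm_eq_of_getElem?
  rw [smul_word, leaves_map, List.getElem?_map, getElem?_leaves]
  rfl

theorem bump_lt {n m : ℕ} (c x : Fin (n + 1)) : bump m c x < n + m + 1 := by
  unfold bump; split_ifs <;> omega

/-- What the letter `x` is replaced by when `w` is inserted for the letter `i`: the letter `i`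
becomes `w` with all its letters increased by `i`, and the letters greater than `i` are increased by
`m`. -/
def substLetter {n m : ℕ} (i : Fin (n + 1)) (w : FreeMagma (Fin (m + 1))) (x : Fin (n + 1)) :
    FreeMagma (Fin (n + m + 1)) :=
  if x = i then FreeMagma.map (fun t : Fin (m + 1) => ⟨i + t, by omega⟩) w
  else FreeMagma.of ⟨bump m i x, bump_lt i x⟩

theorem leaves_substLetter_self {n m : ℕ} (i : Fin (n + 1)) (w : FreeMagma (Fin (m + 1))) :
    leaves (substLetter i w i) = (leaves w).map fun t : Fin (m + 1) => ⟨i + t, by omega⟩ := by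
  rw [substLetter, if_pos rfl, leaves_map]

theorem leaves_substLetter_ne {n m : ℕ} {i : Fin (n + 1)} (w : FreeMagma (Fin (m + 1)))
    {x : Fin (n + 1)} (h : x ≠ i) : leaves (substLetter i w x) = [⟨bump m i x, bump_lt i x⟩] := by
  rw [substLetter, if_neg h, leaves_of]

/-- The insertion `τ ∘_i ω` on objects. -/
def insert {n m : ℕ} (τ : PaB (n + 1)) (i : Fin (n + 1)) (ω : PaB (m + 1)) : PaB (n + m + 1) where
  word := FreeMagma.lift (substLetter i ω.word) τ.word
  nodup := by
    rw [leaves_lift, List.nodup_flatMap]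
    constructor
    · intro x _
      by_cases h : x = i
      · rw [h, leaves_substLetter_self]
        exact ω.nodup.map fun a b e => by simpa [Fin.ext_iff] using e
      · rw [leaves_substLetter_ne _ h]; exact List.nodup_singleton _
    · refine τ.nodup.imp ?_
      intro x y hxy
      rw [Function.onFun, List.disjoint_left]
      intro z hx hy
      have hne : (x : ℕ) ≠ y := fun e => hxy (Fin.ext e)
      by_cases h : x = i
      · subst h
        rw [leaves_substLetter_self, List.mem_map] at hx
        rw [leaves_substLetter_ne _ (Ne.symm hxy), List.mem_singleton] at hy
        obtain ⟨t, _, rfl⟩ := hx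
        rw [Fin.ext_iff] at hy
        simp only [bump] at hy
        split_ifs at hy <;> omega
      · rw [leaves_substLetter_ne _ h, List.mem_singleton] at hx
        subst hx
        have h' : (x : ℕ) ≠ i := fun e => h (Fin.ext e)
        by_cases hy' : y = i
        · subst hy'
          rw [leaves_substLetter_self, List.mem_map] at hy
          obtain ⟨t, _, e⟩ := hy
          rw [Fin.ext_iff] at e
          simp only [bump] at e
          split_ifs at e <;> omega
        · have h'' : (y : ℕ) ≠ i := fun e => hy' (Fin.ext e)
          rw [leaves_substLetter_ne _ hy', List.mem_singleton, Fin.ext_iff] at hy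
          simp only [bump] at hy
          split_ifs at hy <;> omega
  mem := by
    intro y
    rw [leaves_lift, List.mem_flatMap]
    by_cases h1 : (y : ℕ) < i
    · refine ⟨⟨y, by omega⟩, τ.mem _, ?_⟩
      rw [leaves_substLetter_ne _ (by rw [Ne, Fin.ext_iff]; exact ne_of_lt h1), List.mem_singleton]
      simp [bump, h1]
    by_cases h2 : (y : ℕ) ≤ i + m
    · refine ⟨i, τ.mem _, ?_⟩
      rw [leaves_substLetter_self, List.mem_map]
      exact ⟨⟨y - i, by omega⟩, ω.mem _, Fin.ext (by simp only; omega)⟩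
    · refine ⟨⟨y - m, by omega⟩, τ.mem _, ?_⟩
      rw [leaves_substLetter_ne _ (by rw [Ne, Fin.ext_iff]; simp only; omega), List.mem_singleton]
      apply Fin.ext
      simp only [bump]
      split_ifs <;> omega

theorem flatMap_eq {α β : Type} (l : List α) (F : α → List β) (r : α → β) {p : ℕ} {i : α}
    (hp : l[p]? = some i) (hF : ∀ (k : ℕ) (x : α), l[k]? = some x → k ≠ p → F x = [r x]) :
    l.flatMap F = (l.take p).map r ++ F i ++ (l.drop (p + 1)).map r := by
  induction l generalizing p with
  | nil => simp at hp
  | cons a l ih =>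
    cases p with
    | zero =>
      have ha : a = i := by simpa using hp
      subst ha
      have : l.flatMap F = l.map r := by
        rw [List.map_eq_flatMap]
        refine List.flatMap_congr fun x hx => ?_
        obtain ⟨k, hk⟩ := List.mem_iff_getElem?.1 hx
        exact hF (k + 1) x (by simpa using hk) (by omega)
      simp [this]
    | succ p =>
      have := ih (p := p) (by simpa using hp)
        (fun k x hk hne => hF (k + 1) x (by simpa using hk) (by omega))
      simp [this, hF 0 a (by simp) (by omega)]

theorem leaves_insert {n m : ℕ} (τ : PaB (n + 1)) (i : Fin (n + 1)) (ω : PaB (m + 1)) :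
    leaves (insert τ i ω).word =
      ((leaves τ.word).take ((perm τ)⁻¹ i : Fin (n + 1))).map
        (fun x => ⟨bump m i x, bump_lt i x⟩) ++
      ((leaves ω.word).map fun t : Fin (m + 1) => ⟨i + t, by omega⟩) ++
      ((leaves τ.word).drop (((perm τ)⁻¹ i : Fin (n + 1)) + 1)).map
        (fun x => ⟨bump m i x, bump_lt i x⟩) := by
  rw [← leaves_substLetter_self]
  change leaves (FreeMagma.lift _ _) = _
  rw [leaves_lift]
  refine flatMap_eq _ _ _ (by rw [getElem?_leaves]; simp) ?_
  intro k x hk hne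
  refine leaves_substLetter_ne _ ?_
  rintro rfl
  have hk' : k < n + 1 := by
    have := (List.getElem?_eq_some_iff.1 hk).1
    rwa [length_leaves] at this
  have : perm τ ⟨k, hk'⟩ = x := perm_eq_of_getElem? hk
  apply hne
  rw [← this]
  simp

theorem perm_insert_mid {n m : ℕ} (τ : PaB (n + 1)) (i : Fin (n + 1)) (ω : PaB (m + 1))
    (q : Fin (n + m + 1)) (t : Fin (m + 1)) (hq : (q : ℕ) = ((perm τ)⁻¹ i : Fin (n + 1)) + t) :
    perm (insert τ i ω) q = ⟨i + perm ω t, by omega⟩ := by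
  have hp := ((perm τ)⁻¹ i).2
  apply perm_eq_of_getElem?
  have hl : ((leaves τ.word).take ((perm τ)⁻¹ i : Fin (n + 1))).length =
      ((perm τ)⁻¹ i : Fin (n + 1)) := by
    rw [List.length_take, length_leaves]; omega
  rw [leaves_insert, List.getElem?_append_left, List.getElem?_append_right]
  · rw [List.length_map, hl, hq, Nat.add_sub_cancel_left, List.getElem?_map, getElem?_leaves]
    rfl
  · rw [List.length_map, hl]; omega
  · rw [List.length_append, List.length_map, hl, List.length_map, length_leaves]; omega

theorem perm_insert_other {n m : ℕ} (τ : PaB (n + 1)) (i : Fin (n + 1)) (ω : PaB (m + 1))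
    (q : Fin (n + m + 1)) (x : Fin (n + 1)) (hx : x ≠ (perm τ)⁻¹ i)
    (hq : (q : ℕ) = bump m ((perm τ)⁻¹ i : Fin (n + 1)) x) :
    perm (insert τ i ω) q = ⟨bump m i (perm τ x : Fin (n + 1)), bump_lt _ _⟩ := by
  have hp := ((perm τ)⁻¹ i).2
  apply perm_eq_of_getElem?
  have hl : ((leaves τ.word).take ((perm τ)⁻¹ i : Fin (n + 1))).length =
      ((perm τ)⁻¹ i : Fin (n + 1)) := by
    rw [List.length_take, length_leaves]; omega
  have hne : (x : ℕ) ≠ ((perm τ)⁻¹ i : Fin (n + 1)) := fun e => hx (Fin.ext e)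
  rw [leaves_insert]
  unfold bump at hq
  split_ifs at hq with h
  · rw [List.append_assoc, List.getElem?_append_left, List.getElem?_map, hq,
      List.getElem?_take_of_lt h, getElem?_leaves]
    · rfl
    · rw [List.length_map, hl]; omega
  · rw [List.getElem?_append_right, List.length_append, List.length_map, hl, List.length_map,
      length_leaves, List.getElem?_map, List.getElem?_drop,
      show ((perm τ)⁻¹ i : Fin (n + 1)) + 1 + ((q : ℕ) - (((perm τ)⁻¹ i : Fin (n + 1)) + (m + 1))) =
        (x : ℕ) by omega, getElem?_leaves]
    · rfl
    · rw [List.length_append, List.length_map, hl, List.length_map, length_leaves]; omega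

/-- Morphisms of `PaB(n)` from `τ₁` to `τ₂`: braids whose underlying permutation carries the
positions of the letters in `τ₁` to the positions of the same letters in `τ₂`. -/
@[ext]
structure Hom {n : ℕ} (τ₁ τ₂ : PaB n) where
  /-- The underlying braid. -/
  ou : B n
  rho_ou : rho n ou = (perm τ₂)⁻¹ * perm τ₁

/-- `PaB(n)` is a groupoid; the composite of `γ` followed by `η` is given by the product `η * γ` of
braids. -/
instance (n : ℕ) : Groupoid (PaB n) where
  Hom τ₁ τ₂ := Hom τ₁ τ₂
  id τ := ⟨1, by simp⟩
  comp γ η := ⟨η.ou * γ.ou, by rw [map_mul, η.rho_ou, γ.rho_ou]; group⟩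
  inv γ := ⟨γ.ou⁻¹, by rw [map_inv, γ.rho_ou]; group⟩
  id_comp γ := Hom.ext (mul_one _)
  comp_id γ := Hom.ext (one_mul _)
  assoc γ η δ := Hom.ext (mul_assoc _ _ _).symm
  inv_comp γ := Hom.ext (mul_inv_cancel _)
  comp_inv γ := Hom.ext (inv_mul_cancel _)

/-- The underlying braid of a morphism of `PaB(n)`. -/
def ou {n : ℕ} {τ₁ τ₂ : PaB n} (γ : τ₁ ⟶ τ₂) : B n := Hom.ou γ

theorem rho_ou {n : ℕ} {τ₁ τ₂ : PaB n} (γ : τ₁ ⟶ τ₂) :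
    rho n (ou γ) = (perm τ₂)⁻¹ * perm τ₁ := Hom.rho_ou γ

theorem ou_comp {n : ℕ} {τ₁ τ₂ τ₃ : PaB n} (γ : τ₁ ⟶ τ₂) (η : τ₂ ⟶ τ₃) :
    ou (γ ≫ η) = ou η * ou γ := rfl

theorem ou_id {n : ℕ} (τ : PaB n) : ou (𝟙 τ) = 1 := rfl

theorem ou_inv {n : ℕ} {τ₁ τ₂ : PaB n} (γ : τ₁ ⟶ τ₂) : ou (Groupoid.inv γ) = (ou γ)⁻¹ := rfl

/-- The morphism with a given underlying braid. -/
def homMk {n : ℕ} {τ₁ τ₂ : PaB n} (g : B n) (h : ∀ k, perm τ₂ (rho n g k) = perm τ₁ k) :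
    τ₁ ⟶ τ₂ :=
  Hom.mk g (by ext1 k; rw [Equiv.Perm.mul_apply, ← h k]; simp)

theorem perm_rho_ou {n : ℕ} {τ₁ τ₂ : PaB n} (γ : τ₁ ⟶ τ₂) (k : Fin n) :
    perm τ₂ (rho n (ou γ) k) = perm τ₁ k := by
  rw [rho_ou]; simp

/-- The action of `S_n` on morphisms: the underlying braid does not change. -/
def smulHom {n : ℕ} (θ : Equiv.Perm (Fin n)) {τ₁ τ₂ : PaB n} (γ : τ₁ ⟶ τ₂) : θ • τ₁ ⟶ θ • τ₂ :=
  Hom.mk (ou γ) (by rw [rho_ou, perm_smul, perm_smul]; group)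

/-- The insertion `γ ∘_i η` on morphisms: the strand of `γ` that starts at the letter `i` is replaced
by a thin version of `η`. -/
def insertHom {n m : ℕ} {τ₁ τ₂ : PaB (n + 1)} (γ : τ₁ ⟶ τ₂) (i : Fin (n + 1))
    {ω₁ ω₂ : PaB (m + 1)} (η : ω₁ ⟶ ω₂) : insert τ₁ i ω₁ ⟶ insert τ₂ i ω₂ :=
  homMk (cable (ou γ) ((perm τ₁)⁻¹ i) m * shift ((perm τ₁)⁻¹ i : Fin (n + 1)) (by omega) (ou η)) (by
    intro q
    have hp : rho (n + 1) (ou γ) ((perm τ₁)⁻¹ i) = (perm τ₂)⁻¹ i := by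
      rw [rho_ou]; simp
    have hc := isCable_cable (ou γ) ((perm τ₁)⁻¹ i) m
    unfold IsCable at hc
    rw [hp] at hc
    rw [map_mul, Equiv.Perm.mul_apply]
    by_cases h : ((perm τ₁)⁻¹ i : Fin (n + 1)) ≤ (q : ℕ) ∧
        (q : ℕ) ≤ ((perm τ₁)⁻¹ i : Fin (n + 1)) + m
    · have hq : (q : ℕ) = ((perm τ₁)⁻¹ i : Fin (n + 1)) +
          (⟨q - ((perm τ₁)⁻¹ i : Fin (n + 1)), by omega⟩ : Fin (m + 1)) := by
        simp only; omega
      rw [perm_insert_mid τ₁ i ω₁ q _ hq, perm_insert_mid τ₂ i ω₂ _ _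
        (hc.1 _ _ (by omega) (rho_shift_mid _ (ou η) _ q hq))]
      simp only [perm_rho_ou]
    · obtain ⟨x, hx, hq⟩ : ∃ x : Fin (n + 1), x ≠ (perm τ₁)⁻¹ i ∧
          (q : ℕ) = bump m ((perm τ₁)⁻¹ i : Fin (n + 1)) x := by
        by_cases h' : (q : ℕ) < ((perm τ₁)⁻¹ i : Fin (n + 1))
        · refine ⟨⟨q, by omega⟩, by rw [Ne, Fin.ext_iff]; simp only; omega, ?_⟩
          simp only [bump]; split_ifs; rfl
        · refine ⟨⟨q - m, by omega⟩, by rw [Ne, Fin.ext_iff]; simp only; omega, ?_⟩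
          simp only [bump]; split_ifs <;> omega
      rw [rho_shift_out _ _ q (by omega), perm_insert_other τ₁ i ω₁ q x hx hq,
        perm_insert_other τ₂ i ω₂ _ (rho (n + 1) (ou γ) x) (by
          rw [← hp]
          exact fun e => hx ((rho (n + 1) (ou γ)).injective e)) (hc.2 q x hx hq)]
      rw [Fin.mk.injEq, perm_rho_ou])

end PaB

/-- The equivalence relation `∼_N` on the morphisms of `PaB(n)` from `τ₁` to `τ₂`. -/
def simN (N : GTSh) {n : ℕ} (τ₁ τ₂ : PaB n) : Setoid (τ₁ ⟶ τ₂) where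
  r γ γ' := (PaB.ou γ)⁻¹ * PaB.ou γ' ∈ N.sub n
  iseqv :=
    { refl := fun γ => by rw [inv_mul_cancel]; exact one_mem _
      symm := fun {γ γ'} h => by simpa using inv_mem h
      trans := fun {γ γ' γ''} h h' => by
        have := mul_mem h h'
        rwa [mul_assoc, mul_inv_cancel_left] at this }

/-- The morphisms from `τ₁` to `τ₂` in `PaB(n) / ∼_N`. -/
def QHom (N : GTSh) {n : ℕ} (τ₁ τ₂ : PaB n) : Type := Quotient (simN N τ₁ τ₂)

namespace QHom

variable {N : GTSh} {n : ℕ}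

/-- The class `[γ]` of a morphism `γ` of `PaB(n)`. -/
def mk (N : GTSh) {τ₁ τ₂ : PaB n} (γ : τ₁ ⟶ τ₂) : QHom N τ₁ τ₂ := Quotient.mk (simN N τ₁ τ₂) γ

theorem mk_eq {τ₁ τ₂ : PaB n} {γ γ' : τ₁ ⟶ τ₂} :
    mk N γ = mk N γ' ↔ (PaB.ou γ)⁻¹ * PaB.ou γ' ∈ N.sub n :=
  Quotient.eq (r := simN N τ₁ τ₂)

theorem ind {τ₁ τ₂ : PaB n} {C : QHom N τ₁ τ₂ → Prop} (h : ∀ γ, C (mk N γ)) (c : QHom N τ₁ τ₂) :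
    C c :=
  Quotient.ind h c

/-- The identity morphisms `[id_τ]`. -/
def id (N : GTSh) (τ : PaB n) : QHom N τ τ := mk N (𝟙 τ)

/-- The composition `[γ]` followed by `[η]` is the class of `γ` followed by `η`. -/
def comp {τ₁ τ₂ τ₃ : PaB n} : QHom N τ₁ τ₂ → QHom N τ₂ τ₃ → QHom N τ₁ τ₃ :=
  Quotient.map₂ (fun γ η => γ ≫ η) (by
    intro γ γ' h η η' h'
    change (PaB.ou γ)⁻¹ * PaB.ou γ' ∈ N.sub n at h
    change (PaB.ou η)⁻¹ * PaB.ou η' ∈ N.sub n at h'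
    change (PaB.ou (γ ≫ η))⁻¹ * PaB.ou (γ' ≫ η') ∈ N.sub n
    have := mul_mem ((N.sub_normal n).conj_mem _ h' (PaB.ou γ)⁻¹) h
    rw [PaB.ou_comp, PaB.ou_comp]
    convert this using 1
    group)

/-- The inverse of `[γ]` is `[γ⁻¹]`. -/
def inv {τ₁ τ₂ : PaB n} : QHom N τ₁ τ₂ → QHom N τ₂ τ₁ :=
  Quotient.map Groupoid.inv (by
    intro γ γ' h
    change (PaB.ou γ)⁻¹ * PaB.ou γ' ∈ N.sub n at h
    change (PaB.ou (Groupoid.inv γ))⁻¹ * PaB.ou (Groupoid.inv γ') ∈ N.sub n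
    have := (N.sub_normal n).conj_mem _ (inv_mem h) (PaB.ou γ)
    rw [PaB.ou_inv, PaB.ou_inv]
    convert this using 1
    group)

/-- The action of `S_n`: `θ([γ]) = [θ(γ)]`. -/
def smul (θ : Equiv.Perm (Fin n)) {τ₁ τ₂ : PaB n} : QHom N τ₁ τ₂ → QHom N (θ • τ₁) (θ • τ₂) :=
  Quotient.map (PaB.smulHom θ) (fun _ _ h => h)

/-- The elementary insertions: `[γ] ∘_i [η] = [γ ∘_i η]`. -/
def insert {n m : ℕ} (h : n + m + 1 ≤ 4) {τ₁ τ₂ : PaB (n + 1)} (i : Fin (n + 1))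
    {ω₁ ω₂ : PaB (m + 1)} :
    QHom N τ₁ τ₂ → QHom N ω₁ ω₂ → QHom N (τ₁.insert i ω₁) (τ₂.insert i ω₂) :=
  Quotient.map₂ (fun γ η => PaB.insertHom γ i η) (by
    intro γ γ' hγ η η' hη
    change (PaB.ou γ)⁻¹ * PaB.ou γ' ∈ N.sub (n + 1) at hγ
    change (PaB.ou η)⁻¹ * PaB.ou η' ∈ N.sub (m + 1) at hη
    exact N.insert_mem_sub h ((PaB.perm τ₁)⁻¹ i) (by rw [PaB.rho_ou, PaB.rho_ou]) hγ hη)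

end QHom

/-- The objects of the groupoid `PaB(n) / ∼_N`: they are the same as those of `PaB(n)`. -/
def PaBMod (_ : GTSh) (n : ℕ) : Type := PaB n

/-- The quotient `PaB(n) / ∼_N` is a groupoid. -/
instance (N : GTSh) (n : ℕ) : Groupoid (PaBMod N n) where
  Hom (τ₁ τ₂ : PaB n) := QHom N τ₁ τ₂
  id (τ : PaB n) := QHom.id N τ
  comp c d := QHom.comp c d
  inv c := QHom.inv c
  id_comp {τ₁ τ₂} c := by
    induction c using QHom.ind with | h γ => exact congrArg (QHom.mk N) (Category.id_comp γ)
  comp_id c := by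
    induction c using QHom.ind with | h γ => exact congrArg (QHom.mk N) (Category.comp_id γ)
  assoc c d e := by
    induction c using QHom.ind with | h γ => ?_
    induction d using QHom.ind with | h η => ?_
    induction e using QHom.ind with | h δ => exact congrArg (QHom.mk N) (Category.assoc γ η δ)
  inv_comp c := by
    induction c using QHom.ind with | h γ => exact congrArg (QHom.mk N) (Groupoid.inv_comp γ)
  comp_inv c := by
    induction c using QHom.ind with | h γ => exact congrArg (QHom.mk N) (Groupoid.comp_inv γ)

/-- Isomorphisms of truncated operads in groupoids `PaB^{≤ 4} / ∼_{N₁} → PaB^{≤ 4} / ∼_{N₂}` that are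
the identity on objects: functors in the arities `1, 2, 3, 4` that are bijective on morphisms and
compatible with the actions of the symmetric groups and with the elementary insertions whose
result has arity at most `4`. -/
@[ext]
structure OperadIso (N₁ N₂ : GTSh) where
  /-- The bijections on morphisms in arity `n + 1`. -/
  map : ∀ (n : ℕ) (_ : n + 1 ≤ 4) (τ₁ τ₂ : PaB (n + 1)), QHom N₁ τ₁ τ₂ ≃ QHom N₂ τ₁ τ₂
  map_id : ∀ (n : ℕ) (hn : n + 1 ≤ 4) (τ : PaB (n + 1)),
    map n hn τ τ (QHom.id N₁ τ) = QHom.id N₂ τ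
  map_comp : ∀ (n : ℕ) (hn : n + 1 ≤ 4) (τ₁ τ₂ τ₃ : PaB (n + 1)) (c : QHom N₁ τ₁ τ₂)
    (d : QHom N₁ τ₂ τ₃),
    map n hn τ₁ τ₃ (c.comp d) = (map n hn τ₁ τ₂ c).comp (map n hn τ₂ τ₃ d)
  map_smul : ∀ (n : ℕ) (hn : n + 1 ≤ 4) (θ : Equiv.Perm (Fin (n + 1))) (τ₁ τ₂ : PaB (n + 1))
    (c : QHom N₁ τ₁ τ₂),
    map n hn (θ • τ₁) (θ • τ₂) (c.smul θ) = (map n hn τ₁ τ₂ c).smul θ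
  map_insert : ∀ (n m : ℕ) (h : n + m + 1 ≤ 4) (i : Fin (n + 1)) (τ₁ τ₂ : PaB (n + 1))
    (ω₁ ω₂ : PaB (m + 1)) (c : QHom N₁ τ₁ τ₂) (d : QHom N₁ ω₁ ω₂),
    map (n + m) h (τ₁.insert i ω₁) (τ₂.insert i ω₂) (c.insert h i d) =
      (map n (by omega) τ₁ τ₂ c).insert h i (map m (by omega) ω₁ ω₂ d)

namespace OperadIso

/-- The identity isomorphism. -/
def refl (N : GTSh) : OperadIso N N where
  map _ _ _ _ := Equiv.refl _
  map_id _ _ _ := rfl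
  map_comp _ _ _ _ _ _ _ := rfl
  map_smul _ _ _ _ _ _ := rfl
  map_insert _ _ _ _ _ _ _ _ _ _ := rfl

/-- The composite: `S` followed by `T`. -/
def trans {N₁ N₂ N₃ : GTSh} (S : OperadIso N₁ N₂) (T : OperadIso N₂ N₃) : OperadIso N₁ N₃ where
  map n hn τ₁ τ₂ := (S.map n hn τ₁ τ₂).trans (T.map n hn τ₁ τ₂)
  map_id n hn τ := by simp only [Equiv.trans_apply, S.map_id, T.map_id]
  map_comp n hn τ₁ τ₂ τ₃ c d := by simp only [Equiv.trans_apply, S.map_comp, T.map_comp]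
  map_smul n hn θ τ₁ τ₂ c := by simp only [Equiv.trans_apply, S.map_smul, T.map_smul]
  map_insert n m h i τ₁ τ₂ ω₁ ω₂ c d := by
    simp only [Equiv.trans_apply, S.map_insert, T.map_insert]

/-- The inverse isomorphism. -/
def symm {N₁ N₂ : GTSh} (T : OperadIso N₁ N₂) : OperadIso N₂ N₁ where
  map n hn τ₁ τ₂ := (T.map n hn τ₁ τ₂).symm
  map_id n hn τ := by rw [Equiv.symm_apply_eq, T.map_id]
  map_comp n hn τ₁ τ₂ τ₃ c d := by
    rw [Equiv.symm_apply_eq, T.map_comp, Equiv.apply_symm_apply, Equiv.apply_symm_apply]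
  map_smul n hn θ τ₁ τ₂ c := by rw [Equiv.symm_apply_eq, T.map_smul, Equiv.apply_symm_apply]
  map_insert n m h i τ₁ τ₂ ω₁ ω₂ c d := by
    rw [Equiv.symm_apply_eq, T.map_insert, Equiv.apply_symm_apply, Equiv.apply_symm_apply]

end OperadIso

theorem OperadIso.ext_map {N₁ N₂ : GTSh} {S T : OperadIso N₁ N₂}
    (h : ∀ n hn τ₁ τ₂ c, S.map n hn τ₁ τ₂ c = T.map n hn τ₁ τ₂ c) : S = T := by
  apply OperadIso.ext
  funext n hn τ₁ τ₂
  exact Equiv.ext (h n hn τ₁ τ₂)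

theorem OperadIso.trans_map {N₁ N₂ N₃ : GTSh} (S : OperadIso N₁ N₂) (T : OperadIso N₂ N₃) (n : ℕ)
    (hn : n + 1 ≤ 4) (τ₁ τ₂ : PaB (n + 1)) (c : QHom N₁ τ₁ τ₂) :
    (S.trans T).map n hn τ₁ τ₂ c = T.map n hn τ₁ τ₂ (S.map n hn τ₁ τ₂ c) := rfl

theorem OperadIso.refl_trans {N₁ N₂ : GTSh} (T : OperadIso N₁ N₂) :
    (OperadIso.refl N₁).trans T = T := by
  apply OperadIso.ext_map
  intro n hn τ₁ τ₂ c
  rfl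

theorem OperadIso.trans_refl {N₁ N₂ : GTSh} (T : OperadIso N₁ N₂) :
    T.trans (OperadIso.refl N₂) = T := by
  apply OperadIso.ext_map
  intro n hn τ₁ τ₂ c
  rfl

theorem OperadIso.trans_assoc {N₁ N₂ N₃ N₄ : GTSh} (S : OperadIso N₁ N₂) (T : OperadIso N₂ N₃)
    (U : OperadIso N₃ N₄) : (S.trans T).trans U = S.trans (T.trans U) := by
  apply OperadIso.ext_map
  intro n hn τ₁ τ₂ c
  simp only [OperadIso.trans_map]

theorem OperadIso.symm_trans {N₁ N₂ : GTSh} (T : OperadIso N₁ N₂) :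
    T.symm.trans T = OperadIso.refl N₂ := by
  apply OperadIso.ext_map
  intro n hn τ₁ τ₂ c
  exact (T.map n hn τ₁ τ₂).apply_symm_apply c

theorem OperadIso.trans_symm {N₁ N₂ : GTSh} (T : OperadIso N₁ N₂) :
    T.trans T.symm = OperadIso.refl N₁ := by
  apply OperadIso.ext_map
  intro n hn τ₁ τ₂ c
  exact (T.map n hn τ₁ τ₂).symm_apply_apply c

/-- The groupoid of `GT`-shadows: the morphisms from `N₁` to `N₂` are the isomorphisms of truncated
operads `PaB^{≤ 4} / ∼_{N₁} → PaB^{≤ 4} / ∼_{N₂}`. -/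
instance : Groupoid GTSh where
  Hom N₁ N₂ := OperadIso N₁ N₂
  id N := OperadIso.refl N
  comp S T := S.trans T
  inv T := T.symm
  id_comp T := OperadIso.refl_trans T
  comp_id T := OperadIso.trans_refl T
  assoc S T U := OperadIso.trans_assoc S T U
  inv_comp T := OperadIso.symm_trans T
  comp_inv T := OperadIso.trans_symm T

/-- The object `12` of `PaB(2)`. -/
def ob12 : PaB 2 := ⟨.of 0 * .of 1, by decide, by decide⟩

/-- The object `21` of `PaB(2)`. -/
def ob21 : PaB 2 := ⟨.of 1 * .of 0, by decide, by decide⟩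

/-- The object `(12)3` of `PaB(3)`. -/
def ob12_3 : PaB 3 := ⟨.of 0 * .of 1 * .of 2, by decide, by decide⟩

/-- The object `1(23)` of `PaB(3)`. -/
def ob1_23 : PaB 3 := ⟨.of 0 * (.of 1 * .of 2), by decide, by decide⟩

/-- The braiding `β : 12 → 21`. -/
def beta : ob12 ⟶ ob21 :=
  PaB.homMk (sig 2 0) (by rw [rho_sig (by omega)]; decide)

/-- The associator `α : (12)3 → 1(23)`. -/
def alpha : ob12_3 ⟶ ob1_23 :=
  PaB.homMk 1 (by rw [map_one]; decide)

/-- The automorphism of an object given by a pure braid. For the objects `12` and `(12)3` this is the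
map usually denoted by `𝔪`. -/
def pureAut {n : ℕ} (τ : PaB n) (h : PB n) : τ ⟶ τ :=
  PaB.homMk (h : B n) (by
    have : rho n (h : B n) = 1 := h.2
    rw [this]; exact fun _ => rfl)

/-- The generator `x_{12} = σ_1²` of `PB_2`. -/
def x12 : PB 2 := ⟨sig 2 0 ^ 2, by
  rw [MonoidHom.mem_ker, map_pow, rho_sig (by omega)]; decide⟩

/-- `T = [(m, f)]`: the isomorphism `T` sends `[β]` to `[β · 𝔪(x_{12}^m)]` and `[α]` to
`[α · 𝔪(f)]`. -/
def IsPair {N₁ N₂ : GTSh} (T : N₁ ⟶ N₂) (m : ℤ) (f : PB 3) : Prop :=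
  OperadIso.map T 1 (by omega) ob12 ob21 (QHom.mk N₁ beta) =
      QHom.mk N₂ (pureAut ob12 (x12 ^ m) ≫ beta) ∧
    OperadIso.map T 2 (by omega) ob12_3 ob1_23 (QHom.mk N₁ alpha) =
      QHom.mk N₂ (pureAut ob12_3 f ≫ alpha)

namespace GTSh

/-- `N_{PB_2}` as a subgroup of `PB_2`. -/
def PB2 (N : GTSh) : Subgroup (PB 2) := (N.sub 2).subgroupOf (PB 2)

/-- `N_{PB_3}` as a subgroup of `PB_3`. -/
def PB3 (N : GTSh) : Subgroup (PB 3) := (N.sub 3).subgroupOf (PB 3)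

/-- The index `N_ord` of `N_{PB_2}` in `PB_2`. -/
noncomputable def ord (N : GTSh) : ℕ := N.PB2.index

instance (N : GTSh) : N.PB2.Normal :=
  haveI := N.sub_normal 2
  inferInstanceAs ((N.sub 2).subgroupOf (PB 2)).Normal

instance (N : GTSh) : N.PB2.FiniteIndex :=
  haveI : (N.sub 2).FiniteIndex := pull_finiteIndex (pull_finiteIndex N.finiteIndex)
  inferInstanceAs ((N.sub 2).subgroupOf (PB 2)).FiniteIndex

end GTSh

theorem exists_zpow_sig (g : B 2) : ∃ k : ℤ, g = sig 2 0 ^ k := by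
  induction g using braid_induction with
  | h1 => exact ⟨0, by simp⟩
  | hs j hj => exact ⟨1, by rw [zpow_one, show j = 0 by omega]⟩
  | hm a b ha hb =>
    obtain ⟨k, rfl⟩ := ha
    obtain ⟨l, rfl⟩ := hb
    exact ⟨k + l, (zpow_add _ _ _).symm⟩
  | hi a ha =>
    obtain ⟨k, rfl⟩ := ha
    exact ⟨-k, (zpow_neg _ _).symm⟩

theorem exists_zpow_x12 (h : PB 2) : ∃ k : ℤ, h = x12 ^ k := by
  obtain ⟨g, hg⟩ := h
  obtain ⟨k, rfl⟩ := exists_zpow_sig g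
  obtain ⟨l, rfl | rfl⟩ := k.even_or_odd'
  · exact ⟨l, Subtype.ext (zpow_mul _ _ _)⟩
  · exfalso
    have hx : rho 2 (sig 2 0 ^ 2) = 1 := x12.2
    have hs : rho 2 (sig 2 0) ≠ 1 := by rw [rho_sig (by omega)]; decide
    rw [MonoidHom.mem_ker, zpow_add, zpow_mul, zpow_one, map_mul, map_zpow] at hg
    apply hs
    simpa [show (sig 2 0 ^ (2 : ℤ)) = sig 2 0 ^ 2 from zpow_ofNat _ 2, hx] using hg

/-- The category of finite cyclic groups. -/
abbrev FinCyclicGrp : Type 1 :=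
  ObjectProperty.FullSubcategory fun G : GrpCat.{0} => Finite G ∧ IsCyclic G

/-- The finite cyclic group `PB_2 / N_{PB_2}`. -/
def cyc (N : GTSh) : FinCyclicGrp where
  obj := GrpCat.of (PB 2 ⧸ N.PB2)
  property := ⟨inferInstanceAs (Finite (PB 2 ⧸ N.PB2)), ⟨(x12 : PB 2 ⧸ N.PB2), by
    intro y
    obtain ⟨h, rfl⟩ := QuotientGroup.mk_surjective y
    obtain ⟨k, rfl⟩ := exists_zpow_x12 h
    exact ⟨k, (QuotientGroup.mk_zpow N.PB2 x12 k).symm⟩⟩⟩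

/-- A group homomorphism, viewed as a morphism of the category of finite cyclic groups. -/
def cycHom {N₁ N₂ : GTSh} (φ : (PB 2 ⧸ N₁.PB2) →* (PB 2 ⧸ N₂.PB2)) : cyc N₁ ⟶ cyc N₂ :=
  ObjectProperty.homMk (GrpCat.ofHom φ)

end GTShadows

namespace GTShadows

open CategoryTheory

/-! ### The finite cyclic group `PB_2 / N_{PB_2}` and its generator. -/

namespace GTSh

/-! Everything rests on two facts: `PB_2` is generated by `x12`, and each hom-set of `PaB(n)/∼_N` is
a torsor under `PB_n / N_{PB_n}`, which acts by precomposition.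

Since `x12` generates `PB_2`, its class generates the finite quotient `PB_2 / N_{PB_2}`, so this
class has order `N_ord`. Hence `x12 ^ k` lies in `N_{PB_2}` exactly when `N_ord` divides `k`
(`x12_zpow_mem_iff`). This describes the subgroup and identifies the quotient with `ZMod N.ord`; it
also shows that `N_{PB_2}` is determined by its index.

The torsor property (`exists_eq_mk_pureAut_comp`, `mk_pureAut_comp_eq_iff`) says that the images of
`[β]` and `[α]` under `T` differ from `[β]` and `[α]` by unique classes in `PB_2` and `PB_3` modulo
the subgroups of the target. These classes are the pair `(m, f)`, with exactly the stated
indeterminacy.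

For the character, restrict `T` to the automorphism group of the object `12`, which is `PB_2 /
N_{PB_2}` (`autClass`). The result is a group isomorphism `cyclotomic T`, visibly functorial in `T`
and defined without choosing `(m, f)`. It forces the two indices, hence the two subgroups, to
coincide. To evaluate it, write the automorphism `x12` as `β : 12 → 21` followed by the relabelled
braiding `21 → 12`. As `T` respects composition and relabelling, the image of `x12` is the class of
`(σ₁ x12^m)² = x12^(2m+1)` (`IsPair.cyclotomic_x12`). The rule `x12 ↦ x12^(2m+1)` is thus invertible
because `T` is, with no separate argument that `2m+1` is a unit. -/

theorem ord_pos (N : GTSh) : 0 < N.ord :=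
  Nat.pos_of_ne_zero Subgroup.FiniteIndex.index_ne_zero

theorem mem_zpowers_mk_x12 (N : GTSh) (y : PB 2 ⧸ N.PB2) :
    y ∈ Subgroup.zpowers (x12 : PB 2 ⧸ N.PB2) := by
  obtain ⟨h, rfl⟩ := QuotientGroup.mk_surjective y
  obtain ⟨k, rfl⟩ := exists_zpow_x12 h
  exact ⟨k, (QuotientGroup.mk_zpow N.PB2 x12 k).symm⟩

/-- A generator has order the cardinality of the group, and the index is by definition the
cardinality of the quotient. -/
theorem orderOf_mk_x12 (N : GTSh) : orderOf (x12 : PB 2 ⧸ N.PB2) = N.ord :=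
  orderOf_eq_card_of_forall_mem_zpowers N.mem_zpowers_mk_x12

/-- Membership is read off from the order of the class of `x12`, so it is never needed that `x12`
has infinite order in `PB_2`. -/
theorem x12_zpow_mem_iff (N : GTSh) (k : ℤ) : x12 ^ k ∈ N.PB2 ↔ (N.ord : ℤ) ∣ k := by
  rw [← QuotientGroup.eq_one_iff, QuotientGroup.mk_zpow, ← orderOf_dvd_iff_zpow_eq_one,
    orderOf_mk_x12]

theorem PB2_eq_zpowers (N : GTSh) : N.PB2 = Subgroup.zpowers (x12 ^ N.ord) := by
  ext h
  constructor
  · intro hh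
    obtain ⟨k, rfl⟩ := exists_zpow_x12 h
    obtain ⟨l, rfl⟩ := (N.x12_zpow_mem_iff k).1 hh
    exact ⟨l, by simp only [zpow_mul, zpow_natCast]⟩
  · rintro ⟨l, rfl⟩
    have := (N.x12_zpow_mem_iff (N.ord * l)).2 (dvd_mul_right _ _)
    simpa only [zpow_mul, zpow_natCast] using this

/-- Composition of morphisms reverses the product of braids; commutativity turns the resulting
anti-homomorphism on automorphisms of `12` into a homomorphism. -/
theorem quotient_mul_comm (N : GTSh) (x y : PB 2 ⧸ N.PB2) : x * y = y * x := by
  obtain ⟨k, rfl⟩ := N.mem_zpowers_mk_x12 x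
  obtain ⟨l, rfl⟩ := N.mem_zpowers_mk_x12 y
  exact zpow_mul_comm _ k l

theorem exists_mulEquiv_zmod (N : GTSh) :
    ∃ e : (PB 2 ⧸ N.PB2) ≃* Multiplicative (ZMod N.ord),
      e (x12 : PB 2 ⧸ N.PB2) = Multiplicative.ofAdd 1 := by
  have hgen : ∀ y : Multiplicative (ZMod N.ord),
      y ∈ Subgroup.zpowers (Multiplicative.ofAdd (1 : ZMod N.ord)) := by
    intro y
    -- An integer representative of `y` serves as the exponent, since `k • 1 = k`.
    obtain ⟨k, hk⟩ := ZMod.intCast_surjective (Multiplicative.toAdd y)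
    refine ⟨k, ?_⟩
    change Multiplicative.ofAdd (1 : ZMod N.ord) ^ k = y
    rw [← ofAdd_zsmul, zsmul_one, hk, ofAdd_toAdd]
  have hord : orderOf (x12 : PB 2 ⧸ N.PB2) =
      orderOf (Multiplicative.ofAdd (1 : ZMod N.ord)) := by
    rw [orderOf_mk_x12, orderOf_ofAdd_eq_addOrderOf, ZMod.addOrderOf_one]
  -- Two cyclic groups whose chosen generators have equal order are isomorphic by matching the
  -- generators.
  exact ⟨mulEquivOfOrderOfEq N.mem_zpowers_mk_x12 hgen hord,
    mulEquivOfOrderOfEq_apply_gen _ _ _⟩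

end GTSh

/-! ### Hom-sets as torsors, and the pair `(m, f)`. -/

theorem ou_pureAut_comp {n : ℕ} {τ₁ τ₂ : PaB n} (h : PB n) (γ : τ₁ ⟶ τ₂) :
    PaB.ou (pureAut τ₁ h ≫ γ) = PaB.ou γ * h := rfl

/-- Every class of morphisms is obtained from a given one by an automorphism of its source. -/
theorem exists_eq_mk_pureAut_comp (N : GTSh) {n : ℕ} {τ₁ τ₂ : PaB n} (γ : τ₁ ⟶ τ₂)
    (c : QHom N τ₁ τ₂) : ∃ h : PB n, c = QHom.mk N (pureAut τ₁ h ≫ γ) := by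
  induction c using QHom.ind with | h η => ?_
  refine ⟨⟨(PaB.ou γ)⁻¹ * PaB.ou η, ?_⟩, ?_⟩
  -- Parallel morphisms have the same underlying permutation, so their braids differ by a pure
  -- braid.
  · rw [MonoidHom.mem_ker, map_mul, map_inv, PaB.rho_ou, PaB.rho_ou, inv_mul_cancel]
  · refine congrArg (QHom.mk N) (PaB.Hom.ext ?_)
    exact (mul_inv_cancel_left (PaB.ou γ) (PaB.ou η)).symm

/-- With `g` the braid of `γ`, the two sides have braids `g h` and `g h'`, and `g` cancels in `(g
h)⁻¹ (g h')`. This is the freeness half of the torsor property. -/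
theorem mk_pureAut_comp_eq_iff (N : GTSh) {n : ℕ} {τ₁ τ₂ : PaB n} (γ : τ₁ ⟶ τ₂) (h h' : PB n) :
    QHom.mk N (pureAut τ₁ h ≫ γ) = QHom.mk N (pureAut τ₁ h' ≫ γ) ↔
      h⁻¹ * h' ∈ (N.sub n).subgroupOf (PB n) := by
  rw [QHom.mk_eq, ou_pureAut_comp, ou_pureAut_comp, Subgroup.mem_subgroupOf, mul_inv_rev,
    mul_assoc, inv_mul_cancel_left]
  rfl

theorem exists_isPair {N₁ N₂ : GTSh} (T : N₁ ⟶ N₂) : ∃ (m : ℤ) (f : PB 3), IsPair T m f := by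
  obtain ⟨h, hh⟩ := exists_eq_mk_pureAut_comp N₂ beta
    (OperadIso.map T 1 (by omega) ob12 ob21 (QHom.mk N₁ beta))
  obtain ⟨f, hf⟩ := exists_eq_mk_pureAut_comp N₂ alpha
    (OperadIso.map T 2 (by omega) ob12_3 ob1_23 (QHom.mk N₁ alpha))
  obtain ⟨m, rfl⟩ := exists_zpow_x12 h
  exact ⟨m, f, hh, hf⟩

/-- Once the known values of `T` are substituted, only classes in the target quotient are compared,
which is why the ambiguity is governed by `N₂`. In arity 2 the condition is that `x12 ^ (m' - m)`
lies in `N₂.PB2`. -/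
theorem IsPair.iff_congr {N₁ N₂ : GTSh} {T : N₁ ⟶ N₂} {m : ℤ} {f : PB 3} (hT : IsPair T m f)
    (m' : ℤ) (f' : PB 3) :
    IsPair T m' f' ↔ m ≡ m' [ZMOD (N₂.ord : ℤ)] ∧ f⁻¹ * f' ∈ N₂.PB3 := by
  unfold IsPair
  rw [hT.1, hT.2, mk_pureAut_comp_eq_iff, mk_pureAut_comp_eq_iff]
  refine and_congr ?_ Iff.rfl
  change _ ∈ N₂.PB2 ↔ _
  rw [← zpow_neg, ← zpow_add, N₂.x12_zpow_mem_iff, Int.modEq_iff_dvd, neg_add_eq_sub]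

/-! ### The action of a morphism on the automorphism group of `12`. -/

/-- The classes of the automorphisms of `12` are the elements of `PB_2 / N_{PB_2}`. -/
noncomputable def autClass (N : GTSh) : (PB 2 ⧸ N.PB2) ≃ QHom N ob12 ob12 :=
  Equiv.ofBijective
    (Quotient.lift (fun h : PB 2 => QHom.mk N (pureAut ob12 h)) fun h h' hh =>
      QHom.mk_eq.2 (show h⁻¹ * h' ∈ N.PB2 from QuotientGroup.leftRel_apply.1 hh))
    ⟨by
      rintro ⟨h⟩ ⟨h'⟩ e
      exact QuotientGroup.eq.2 (QHom.mk_eq.1 e),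
    by
      intro c
      -- Surjectivity is the torsor property with the identity as base point.
      obtain ⟨h, rfl⟩ := exists_eq_mk_pureAut_comp N (𝟙 ob12) c
      exact ⟨(h : PB 2 ⧸ N.PB2), by rw [Category.comp_id]; rfl⟩⟩

theorem autClass_mk (N : GTSh) (h : PB 2) :
    autClass N (h : PB 2 ⧸ N.PB2) = QHom.mk N (pureAut ob12 h) := rfl

theorem autClass_mul (N : GTSh) (x y : PB 2 ⧸ N.PB2) :
    autClass N (x * y) = (autClass N x).comp (autClass N y) := by
  -- After the swap both sides are the class of the same braid, because `γ ≫ η` has braid `ou η * ou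
  -- γ`.
  rw [N.quotient_mul_comm]
  obtain ⟨h, rfl⟩ := QuotientGroup.mk_surjective x
  obtain ⟨k, rfl⟩ := QuotientGroup.mk_surjective y
  rfl

/-- The action of a morphism of `GTSh` on the automorphisms of `12`. -/
noncomputable def cyclotomic {N₁ N₂ : GTSh} (T : N₁ ⟶ N₂) :
    (PB 2 ⧸ N₁.PB2) ≃* (PB 2 ⧸ N₂.PB2) where
  toEquiv := ((autClass N₁).trans (OperadIso.map T 1 (by omega) ob12 ob12)).trans
    (autClass N₂).symm
  map_mul' x y := by
    simp only [Equiv.toFun_as_coe, Equiv.trans_apply]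
    rw [Equiv.symm_apply_eq, autClass_mul, autClass_mul, OperadIso.map_comp,
      Equiv.apply_symm_apply, Equiv.apply_symm_apply]

theorem autClass_cyclotomic {N₁ N₂ : GTSh} (T : N₁ ⟶ N₂) (x : PB 2 ⧸ N₁.PB2) :
    autClass N₂ (cyclotomic T x) = OperadIso.map T 1 (by omega) ob12 ob12 (autClass N₁ x) :=
  (autClass N₂).apply_symm_apply _

theorem cyclotomic_id (N : GTSh) (x : PB 2 ⧸ N.PB2) : cyclotomic (𝟙 N) x = x :=
  (autClass N).injective (autClass_cyclotomic (𝟙 N) x)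

theorem cyclotomic_comp {N₁ N₂ N₃ : GTSh} (S : N₁ ⟶ N₂) (T : N₂ ⟶ N₃) (x : PB 2 ⧸ N₁.PB2) :
    cyclotomic (S ≫ T) x = cyclotomic T (cyclotomic S x) := by
  apply (autClass N₃).injective
  rw [autClass_cyclotomic, autClass_cyclotomic, autClass_cyclotomic]
  rfl

/-! ### The value on `x12`. -/

/-- The morphism `21 → 12` obtained from the braiding `β` by exchanging the letters. -/
def betaSwap : ob21 ⟶ ob12 :=
  PaB.homMk (sig 2 0) (by rw [rho_sig (by omega)]; decide)

theorem pureAut_x12 : pureAut ob12 x12 = beta ≫ betaSwap :=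
  PaB.Hom.ext (pow_two _)

/-- Relabelling leaves the underlying braid unchanged and `T` is equivariant, so the exponent `m`
found for `β` is also the one for its relabelling. -/
theorem IsPair.map_betaSwap {N₁ N₂ : GTSh} {T : N₁ ⟶ N₂} {m : ℤ} {f : PB 3}
    (hT : IsPair T m f) :
    OperadIso.map T 1 (by omega) ob21 ob12 (QHom.mk N₁ betaSwap) =
      QHom.mk N₂ (pureAut ob21 (x12 ^ m) ≫ betaSwap) := by
  have h := OperadIso.map_smul T 1 (by omega) (Equiv.swap (0 : Fin 2) 1) ob12 ob21
    (QHom.mk N₁ beta)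
  rw [hT.1] at h
  -- Relabelling by the swap takes `ob12`, `ob21` and `beta` to `ob21`, `ob12` and `betaSwap` by
  -- unfolding definitions.
  exact h

theorem IsPair.cyclotomic_x12 {N₁ N₂ : GTSh} {T : N₁ ⟶ N₂} {m : ℤ} {f : PB 3}
    (hT : IsPair T m f) :
    cyclotomic T (x12 : PB 2 ⧸ N₁.PB2) = ((x12 ^ (2 * m + 1) : PB 2) : PB 2 ⧸ N₂.PB2) := by
  apply (autClass N₂).injective
  rw [autClass_cyclotomic, autClass_mk, autClass_mk, pureAut_x12]
  have h := OperadIso.map_comp T 1 (by omega) ob12 ob21 ob12 (QHom.mk N₁ beta)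
    (QHom.mk N₁ betaSwap)
  rw [hT.1, hT.map_betaSwap] at h
  refine h.trans (congrArg (QHom.mk N₂) (PaB.Hom.ext ?_))
  -- In `B_2` all factors are powers of `σ₁`: both sides equal `σ₁ ^ (4m + 2)`.
  change sig 2 0 * ((x12 ^ m : PB 2) : B 2) * (sig 2 0 * ((x12 ^ m : PB 2) : B 2)) =
    ((x12 ^ (2 * m + 1) : PB 2) : B 2)
  have hx : ∀ k : ℤ, ((x12 ^ k : PB 2) : B 2) = sig 2 0 ^ (2 * k) := fun k => by
    rw [zpow_mul]; rfl
  rw [hx, hx]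
  group

/-- The isomorphism `cyclotomic T` equates the two indices, and a subgroup `N_{PB_2}` is recovered
from its index as the powers of `x12 ^ N.ord`. -/
theorem PB2_eq_of_hom {N₁ N₂ : GTSh} (T : N₁ ⟶ N₂) : N₁.PB2 = N₂.PB2 := by
  have h : N₁.ord = N₂.ord := Nat.card_congr (cyclotomic T).toEquiv
  rw [N₁.PB2_eq_zpowers, N₂.PB2_eq_zpowers, h]

/-! ### The functor and its description by automorphisms. -/

/-- The virtual cyclotomic character. -/
noncomputable def chCyclot : GTSh ⥤ FinCyclicGrp where
  obj := cyc
  map T := cycHom (cyclotomic T).toMonoidHom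
  map_id N :=
    congrArg cycHom (MonoidHom.ext (cyclotomic_id N))
  map_comp S T :=
    congrArg cycHom (MonoidHom.ext (cyclotomic_comp S T))

/-- An isomorphism between the quotients by equal subgroups is an automorphism of the target. -/
theorem exists_mulAut_of_quotient_mulEquiv {G : Type*} [Group G] {H K : Subgroup G} [H.Normal]
    [K.Normal] (h : H = K) (φ : (G ⧸ H) ≃* (G ⧸ K)) :
    ∃ a : MulAut (G ⧸ K), (∀ g : G, a (g : G ⧸ K) = φ (g : G ⧸ H)) ∧
      φ.toMonoidHom = a.toMonoidHom.comp (QuotientGroup.quotientMulEquivOfEq h).toMonoidHom := by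
  -- With the two subgroups identified, `a` is `φ` itself and the comparison isomorphism is the
  -- identity.
  subst h
  refine ⟨φ, fun _ => rfl, MonoidHom.ext fun x => ?_⟩
  obtain ⟨g, rfl⟩ := QuotientGroup.mk_surjective x
  rfl

theorem IsPair.exists_eq_cyclotomic {N₁ N₂ : GTSh} {T : N₁ ⟶ N₂} {m : ℤ} {f : PB 3}
    (hT : IsPair T m f) :
    ∃ (h : N₁.PB2 = N₂.PB2) (a : MulAut (PB 2 ⧸ N₂.PB2)),
      a (x12 : PB 2 ⧸ N₂.PB2) = ((x12 ^ (2 * m + 1) : PB 2) : PB 2 ⧸ N₂.PB2) ∧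
      (cyclotomic T).toMonoidHom =
        a.toMonoidHom.comp (QuotientGroup.quotientMulEquivOfEq h).toMonoidHom := by
  obtain ⟨a, ha, e⟩ := exists_mulAut_of_quotient_mulEquiv (PB2_eq_of_hom T) (cyclotomic T)
  exact ⟨PB2_eq_of_hom T, a, (ha x12).trans hT.cyclotomic_x12, e⟩

/-- The objects agree definitionally, so both transports are identity morphisms. -/
theorem eqToHom_comp_chCyclot_map {N₁ N₂ : GTSh} (T : N₁ ⟶ N₂) (h₁ : cyc N₁ = chCyclot.obj N₁)
    (h₂ : chCyclot.obj N₂ = cyc N₂) :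
    eqToHom h₁ ≫ chCyclot.map T ≫ eqToHom h₂ = cycHom (cyclotomic T).toMonoidHom :=
  (Category.id_comp _).trans (Category.comp_id _)

end GTShadows

open CategoryTheory GTShadows in
/-- The virtual cyclotomic character. -/
theorem corollary2p13 :
    (∀ N : GTSh, 0 < N.ord ∧ N.PB2 = Subgroup.zpowers (x12 ^ N.ord) ∧
      ∃ e : (PB 2 ⧸ N.PB2) ≃* Multiplicative (ZMod N.ord),
        e (x12 : PB 2 ⧸ N.PB2) = Multiplicative.ofAdd 1) ∧
    (∀ (N₁ N₂ : GTSh) (T : N₁ ⟶ N₂), ∃ (m : ℤ) (f : PB 3), IsPair T m f ∧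
      ∀ (m' : ℤ) (f' : PB 3),
        IsPair T m' f' ↔ m ≡ m' [ZMOD (N₂.ord : ℤ)] ∧ f⁻¹ * f' ∈ N₂.PB3) ∧
    ∃ (Ch : GTSh ⥤ FinCyclicGrp) (hobj : ∀ N : GTSh, Ch.obj N = cyc N),
      ∀ (N₁ N₂ : GTSh) (T : N₁ ⟶ N₂) (m : ℤ) (f : PB 3), IsPair T m f →
        ∃ (h : N₁.PB2 = N₂.PB2) (a : MulAut (PB 2 ⧸ N₂.PB2)),
          a (x12 : PB 2 ⧸ N₂.PB2) = ((x12 ^ (2 * m + 1) : PB 2) : PB 2 ⧸ N₂.PB2) ∧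
          eqToHom (hobj N₁).symm ≫ Ch.map T ≫ eqToHom (hobj N₂) =
            cycHom (a.toMonoidHom.comp (QuotientGroup.quotientMulEquivOfEq h).toMonoidHom) := by
  refine ⟨fun N => ⟨N.ord_pos, N.PB2_eq_zpowers, N.exists_mulEquiv_zmod⟩, ?_, chCyclot,
    fun _ => rfl, ?_⟩
  · intro N₁ N₂ T
    obtain ⟨m, f, hT⟩ := exists_isPair T
    exact ⟨m, f, hT, hT.iff_congr⟩
  · intro N₁ N₂ T m f hT
    obtain ⟨h, a, ha, e⟩ := hT.exists_eq_cyclotomic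
    exact ⟨h, a, ha, (eqToHom_comp_chCyclot_map T _ _).trans (congrArg cycHom e)⟩
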